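/- **Setting.** Fix $d\ge 1$ and a *kernel* $K:[0,\infty)\to[0,\infty)$, i.e. a non-increasing, right-continuous function with $0<\int_0^\infty K(r)\,dr<\infty$; assume moreover that $\int_{\mathbb R^d}K(\|x\|)\,dx<\infty$, and for $s>0$ write $v_s=\int_{\mathbb R^d}K(\|x\|/s)\,dx\in(0,\infty)$. *Clusterings.* A clustering of a set $X$ is a set of non-empty pairwise disjoint subsets (clusters) of $X$; $S\preceq T$ means that every cluster of $S$ is contained in a cluster of $T$. A hierarchical clustering $H$ of $X$ assigns a clustering $H(r)$ to every real $r>0$ so that $H(r')\preceq H(r)$ whenever $r\le r'$. For a metric space $X$ with a Borel probability measure $\mu$ and $s,t,k>0$, let $X_{[s,k]}=\{x\in X:\int_X K(d(x,x')/s)\,d\mu(x')\ge k\}$, and let $\mathbb L(X)(s,t,k)$ be the partition of $X_{[s,k]}$ into the classes of the smallest equivalence relation on $X_{[s,k]}$ relating any two points at distance at most $t$. *Curves.* A curve is a continuous map $\gamma=(\gamma_s,\gamma_t,\gamma_k):I_\gamma\to(0,\infty)^3$ on an interval $I_\gamma=(0,\max_\gamma)$, $0<\max_\gamma\le\infty$,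 with $\gamma_s,\gamma_t$ non-increasing and $\gamma_k$ non-decreasing. For a metric probability space $X$, the $\gamma$-linkage of $X$ is the hierarchical clustering with value $\mathbb L(X)(\gamma(r))$ for $r\in I_\gamma$ and $\emptyset$ for $r\ge\max_\gamma$. The curve is *covering* if $\gamma_s$ is strictly decreasing with $\gamma_s(r)\to0$ as $r\to\max_\gamma$ and $\gamma_k$ is strictly increasing with $\gamma_k(r)\to 0$ as $r\to 0$; then $\varphi(r)=\gamma_k(r)/v_{\gamma_s(r)}$ is a bijection $I_\gamma\to(0,\infty)$, and $\overline\gamma=\gamma\circ\varphi^{-1}$ is a curve on $(0,\infty)$. A family $\{\gamma^\theta\}_{\theta\in\Theta}$ of curves is *admissible* if every $\gamma^\theta$ is covering and continuously differentiable with $(\gamma^\theta_s)',(\gamma^\theta_t)'<0$ and $(\gamma^\theta_k)'>0$ on $I_{\gamma^\theta}$, and if for every $b>0$ there is $\theta\in\Theta$ with $\gamma^\theta_s(r),\gamma^\theta_t(r)<b$ for all $r\in I_{\gamma^\theta}$. *Measured interleavings.* A correspondence $R\subseteq X\times Y$ is a subset both of whose projections $\pi_X:R\to X$, $\pi_Y:R\to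 Y$ are surjective. Let $H,E$ be hierarchical clusterings, all of whose clusters are measurable, of measure spaces $(X,\mu_X)$, $(Y,\mu_Y)$. They are *$\varepsilon$-measured-interleaved with respect to $R$* if for all $r>\varepsilon$: every $A\in H(r)$ has a (necessarily unique) $R_X(A)\in E(r-\varepsilon)$ with $\pi_X^{-1}(A)\subseteq\pi_Y^{-1}(R_X(A))$; every $B\in E(r)$ has a (necessarily unique) $R_Y(B)\in H(r-\varepsilon)$ with $\pi_Y^{-1}(B)\subseteq\pi_X^{-1}(R_Y(B))$; and $\mu_X(\bigcup_iA_i)\le\mu_Y(\bigcup_iR_X(A_i))+\varepsilon$ and $\mu_Y(\bigcup_jB_j)\le\mu_X(\bigcup_jR_Y(B_j))+\varepsilon$ for all finite collections of clusters $A_i\in H(r)$ and $B_j\in E(r)$. For subspaces $X,Y$ of a metric space, the *closest point correspondence* $R_c\subseteq X\times Y$ consists of the pairs $(x,y)$ such that $d(x,y)=\min_{y'\in Y}d(x,y')$ or $d(x,y)=\min_{x'\in X}d(x',y)$. **Theorem.** Let $\{\gamma^\theta\}_{\theta\in\Theta}$ be an admissible family of curves, and let $f:\mathbb R^d\to\mathbb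 R$ be a continuous, compactly supported probability density function. Let $\operatorname{supp}(f)=\overline{\{f\ne0\}}$ carry the measure $\mu_f$ with density $f$, and let $H(f)$ be the hierarchical clustering of $\operatorname{supp}(f)$ for which $H(f)(r)$ is the set of connected components of $\{x\in\operatorname{supp}(f):f(x)\ge r\}$. Then $\overline\gamma$-linkage is MI-consistent with respect to $f$: there are parameters $\theta_n\in\Theta$, $n\in\mathbb N$, such that for every $\varepsilon>0$, if $X_n$ is the set of points of an i.i.d. $n$-sample with distribution $\mu_f$, with the Euclidean metric and the normalized counting measure, then the probability that the $\overline{\gamma^{\theta_n}}$-linkage of $X_n$ and $H(f)$ are $\varepsilon$-measured-interleaved with respect to the closest point correspondence $R_c\subseteq X_n\times\operatorname{supp}(f)$ tends to $1$ as $n\to\infty$. -/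

import Mathlib

open Set Filter Topology MeasureTheory

noncomputable section

namespace GammaLinkage

/-- A clustering of `X`: a set of non-empty, pairwise disjoint subsets of `X`. -/
@[ext]
structure Clustering (X : Type*) where
  clusters : Set (Set X)
  nonempty : ∀ A ∈ clusters, A.Nonempty
  disjoint : clusters.PairwiseDisjoint id

namespace Clustering

variable {X Y : Type*}

theorem eq_of_mem (S : Clustering X) {A B : Set X} (hA : A ∈ S.clusters) (hB : B ∈ S.clusters)
    {x : X} (hxA : x ∈ A) (hxB : x ∈ B) : A = B := by
  by_contra h
  exact Set.disjoint_left.1 (S.disjoint hA hB h) hxA hxB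

/-- The poset of clusterings: every cluster of `S` is contained in a cluster of `T`. -/
instance : PartialOrder (Clustering X) where
  le S T := ∀ A ∈ S.clusters, ∃ B ∈ T.clusters, A ⊆ B
  le_refl S A hA := ⟨A, hA, subset_rfl⟩
  le_trans S T U h₁ h₂ A hA := by
    obtain ⟨B, hB, hAB⟩ := h₁ A hA
    obtain ⟨C, hC, hBC⟩ := h₂ B hB
    exact ⟨C, hC, hAB.trans hBC⟩
  le_antisymm S T h₁ h₂ := by
    have key : ∀ S T : Clustering X, (∀ A ∈ S.clusters, ∃ B ∈ T.clusters, A ⊆ B) →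
        (∀ A ∈ T.clusters, ∃ B ∈ S.clusters, A ⊆ B) → S.clusters ⊆ T.clusters := by
      intro S T h₁ h₂ A hA
      obtain ⟨B, hB, hAB⟩ := h₁ A hA
      obtain ⟨C, hC, hBC⟩ := h₂ B hB
      obtain ⟨x, hx⟩ := S.nonempty A hA
      have hAC : A = C := S.eq_of_mem hA hC hx (hBC (hAB hx))
      have hEq : A = B := hAB.antisymm (hAC ▸ hBC)
      exact hEq ▸ hB
    exact Clustering.ext ((key S T h₁ h₂).antisymm (key T S h₂ h₁))

/-- The empty clustering. -/
def empty (X : Type*) : Clustering X where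
  clusters := ∅
  nonempty := by simp
  disjoint := by simp

theorem empty_le (S : Clustering X) : empty X ≤ S := fun _ hA => absurd hA (Set.notMem_empty _)

/-- The pullback `ψ^*(S) = {ψ⁻¹(C) : C ∈ S}`. (Empty preimages are discarded; there are none when
`ψ` is surjective, as the projections of a correspondence are.) -/
def pullback (ψ : Y → X) (S : Clustering X) : Clustering Y where
  clusters := {B | B.Nonempty ∧ ∃ C ∈ S.clusters, B = ψ ⁻¹' C}
  nonempty _ hB := hB.1
  disjoint := by
    rintro _ ⟨-, C, hC, rfl⟩ _ ⟨-, D, hD, rfl⟩ hne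
    have hCD : C ≠ D := fun h => hne (h ▸ rfl)
    exact Disjoint.preimage ψ (S.disjoint hC hD hCD)

theorem pullback_mono (ψ : Y → X) : Monotone (pullback ψ) := by
  rintro S T h _ ⟨⟨y, hy⟩, C, hC, rfl⟩
  obtain ⟨D, hD, hCD⟩ := h C hC
  exact ⟨ψ ⁻¹' D, ⟨⟨y, hCD hy⟩, D, hD, rfl⟩, Set.preimage_mono hCD⟩

/-- A clustering of a subset `U` of `X`, regarded as a clustering of `X`. -/
def ofSubset (U : Set X) (S : Clustering U) : Clustering X where
  clusters := (fun A : Set U => Subtype.val '' A) '' S.clusters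
  nonempty := by
    rintro _ ⟨A, hA, rfl⟩
    exact (S.nonempty A hA).image _
  disjoint := by
    rintro _ ⟨A, hA, rfl⟩ _ ⟨B, hB, rfl⟩ hne
    have hAB : A ≠ B := fun h => hne (h ▸ rfl)
    exact (Set.disjoint_image_iff Subtype.val_injective).2 (S.disjoint hA hB hAB)

end Clustering

/-- The strictly positive real numbers. -/
abbrev PosReal : Type := {r : ℝ // 0 < r}

/-- A (contravariant, one-parameter) hierarchical clustering of `X`. -/
abbrev HierarchicalClustering (X : Type*) : Type _ := PosRealᵒᵈ →o Clustering X

/-- A `(1,1,-1)`-hierarchical clustering of `X`. -/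
abbrev HierarchicalClustering₃ (X : Type*) : Type _ :=
  PosReal × PosReal × PosRealᵒᵈ →o Clustering X

namespace HierarchicalClustering

variable {X Y : Type*}

/-- The clustering at scale `r > 0`. -/
def at' (H : HierarchicalClustering X) (r : ℝ) (hr : 0 < r) : Clustering X :=
  H (OrderDual.toDual ⟨r, hr⟩)

/-- The pullback of a hierarchical clustering along a function. -/
def pullback (ψ : Y → X) (H : HierarchicalClustering X) : HierarchicalClustering Y where
  toFun r := (H r).pullback ψ
  monotone' _ _ h := Clustering.pullback_mono ψ (H.monotone h)

/-- All clusters are measurable sets. -/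
def IsMeasurable [MeasurableSpace X] (H : HierarchicalClustering X) : Prop :=
  ∀ (r : ℝ) (hr : 0 < r), ∀ A ∈ (H.at' r hr).clusters, MeasurableSet A

/-- `ε`-interleaved hierarchical clusterings of the same set. -/
def Interleaved (H E : HierarchicalClustering X) (ε : ℝ) : Prop :=
  ∀ (r : ℝ) (hr : 0 < r) (hrε : 0 < r - ε),
    H.at' r hr ≤ E.at' (r - ε) hrε ∧ E.at' r hr ≤ H.at' (r - ε) hrε

end HierarchicalClustering

/-- `R ⊆ X × Y` is a correspondence: both projections are surjective. -/
def IsCorrespondence {X Y : Type*} (R : Set (X × Y)) : Prop :=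
  (∀ x, ∃ y, (x, y) ∈ R) ∧ (∀ y, ∃ x, (x, y) ∈ R)

/-- `ε`-interleaved with respect to the correspondence `R`: the pullbacks to `R` are
`ε`-interleaved. -/
def InterleavedWrt {X Y : Type*} (H : HierarchicalClustering X) (E : HierarchicalClustering Y)
    (R : Set (X × Y)) (ε : ℝ) : Prop :=
  IsCorrespondence R ∧
    HierarchicalClustering.Interleaved
      (HierarchicalClustering.pullback (fun p : R => p.1.1) H)
      (HierarchicalClustering.pullback (fun p : R => p.1.2) E) ε

/-- The relation `B = R_X(A)`, that is `π_X⁻¹(A) ⊆ π_Y⁻¹(B)`. For an interleaving with respect to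
the correspondence `R`, each `A ∈ H(r)` has exactly one such `B ∈ E(r - ε)`. -/
def Transports {X Y : Type*} (R : Set (X × Y)) (A : Set X) (B : Set Y) : Prop :=
  ∀ p ∈ R, p.1 ∈ A → p.2 ∈ B

/-- `(ε; m)`-measured-interleaved with respect to the correspondence `R`. -/
def MeasuredInterleavedWrt {X Y : Type*} [MeasurableSpace X] [MeasurableSpace Y]
    (μ : Measure X) (ν : Measure Y)
    (H : HierarchicalClustering X) (E : HierarchicalClustering Y)
    (R : Set (X × Y)) (ε m : ℝ) : Prop :=
  H.IsMeasurable ∧ E.IsMeasurable ∧ InterleavedWrt H E R ε ∧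
    ∀ (r : ℝ) (hr : 0 < r) (hrε : 0 < r - ε) (N : ℕ),
      (∀ (A : Fin N → Set X) (B : Fin N → Set Y),
        (∀ i, A i ∈ (H.at' r hr).clusters) → (∀ i, B i ∈ (E.at' (r - ε) hrε).clusters) →
        (∀ i, Transports R (A i) (B i)) →
        μ (⋃ i, A i) ≤ ν (⋃ i, B i) + ENNReal.ofReal m) ∧
      (∀ (B : Fin N → Set Y) (A : Fin N → Set X),
        (∀ i, B i ∈ (E.at' r hr).clusters) → (∀ i, A i ∈ (H.at' (r - ε) hrε).clusters) →
        (∀ i, Transports (Prod.swap ⁻¹' R) (B i) (A i)) →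
        ν (⋃ i, B i) ≤ μ (⋃ i, A i) + ENNReal.ofReal m)

/-- The closest point correspondence of two spaces embedded in a common metric space. -/
def closestPointCorrespondence {X Y Z : Type*} [MetricSpace Z] (i : X → Z) (j : Y → Z) :
    Set (X × Y) :=
  {p | (∀ y', dist (i p.1) (j p.2) ≤ dist (i p.1) (j y')) ∨
    (∀ x', dist (i p.1) (j p.2) ≤ dist (i x') (j p.2))}

/-- The single-linkage covariant hierarchical clustering: at scale `t` the classes of the smallest
equivalence relation relating points at distance at most `t`. -/
def singleLinkage (X : Type*) [MetricSpace X] : PosReal →o Clustering X where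
  toFun t :=
    { clusters := (Relation.EqvGen.setoid fun x y : X => dist x y ≤ t.1).classes
      nonempty := fun A hA =>
        Set.nonempty_iff_ne_empty.2 fun h => Setoid.empty_notMem_classes (h ▸ hA)
      disjoint := (Setoid.isPartition_classes _).pairwiseDisjoint }
  monotone' := by
    rintro t t' h _ ⟨y, rfl⟩
    refine ⟨_, ⟨y, rfl⟩, fun x hx => ?_⟩
    exact Relation.EqvGen.mono (r := fun a b => dist a b ≤ t.1)
      (fun a b (hab : dist a b ≤ t.1) => hab.trans h) x y hx

/-- Kernels: non-increasing, right-continuous `K : ℝ_{≥0} → ℝ_{≥0}` with `0 < ∫ K < ∞`. Only the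
values on `[0, ∞)` matter. -/
structure DensityKernel where
  toFun : ℝ → ℝ
  nonneg : ∀ r, 0 ≤ r → 0 ≤ toFun r
  antitoneOn : AntitoneOn toFun (Ici 0)
  rightContinuous : ∀ r, 0 ≤ r → ContinuousWithinAt toFun (Ici r) r
  integrableOn : IntegrableOn toFun (Ioi 0)
  integral_pos : 0 < ∫ r in Ioi (0 : ℝ), toFun r

instance : CoeFun DensityKernel fun _ => ℝ → ℝ := ⟨DensityKernel.toFun⟩

theorem DensityKernel.measurable_comp {X : Type*} [MeasurableSpace X] (K : DensityKernel)
    {g : X → ℝ} (hg : Measurable g) (h0 : ∀ x, 0 ≤ g x) : Measurable fun x => K (g x) := by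
  have h1 : Antitone fun r : ℝ => K (max r 0) := fun a b hab =>
    K.antitoneOn (le_max_right a 0) (le_max_right b 0) (max_le_max_right 0 hab)
  have h2 := h1.measurable.comp hg
  convert h2 using 2 with x
  simp [max_eq_left (h0 x)]

theorem DensityKernel.integrable_comp {X : Type*} [MeasurableSpace X] (K : DensityKernel)
    (μ : Measure X) [IsFiniteMeasure μ]
    {g : X → ℝ} (hg : Measurable g) (h0 : ∀ x, 0 ≤ g x) : Integrable (fun x => K (g x)) μ := by
  refine Integrable.of_bound (K.measurable_comp hg h0).aestronglyMeasurable (K 0)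
    (ae_of_all _ fun x => ?_)
  rw [Real.norm_of_nonneg (K.nonneg _ (h0 x))]
  exact K.antitoneOn (mem_Ici.2 le_rfl) (h0 x) (h0 x)

section KernelLinkage

variable {X : Type*} [MetricSpace X] [MeasurableSpace X]

/-- The local density estimate at scale `s`. -/
def localDensity (K : DensityKernel) (μ : Measure X) (s : ℝ) (x : X) : ℝ :=
  ∫ x', K (dist x x' / s) ∂μ

/-- The kernel filtration `X_{[s,k]}`. -/
def kernelFiltration (K : DensityKernel) (μ : Measure X) (s k : ℝ) : Set X :=
  {x | k ≤ localDensity K μ s x}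

variable [BorelSpace X]

theorem kernelFiltration_mono (K : DensityKernel) (μ : Measure X) [IsFiniteMeasure μ]
    {s s' k k' : ℝ} (hs : 0 < s) (hss' : s ≤ s') (hk : k' ≤ k) :
    kernelFiltration K μ s k ⊆ kernelFiltration K μ s' k' := by
  intro x hx
  have hs' := hs.trans_le hss'
  refine hk.trans (le_trans hx (integral_mono ?_ ?_ fun y => ?_))
  · exact K.integrable_comp μ (by fun_prop) fun y => div_nonneg dist_nonneg hs.le
  · exact K.integrable_comp μ (by fun_prop) fun y => div_nonneg dist_nonneg hs'.le
  · exact K.antitoneOn (div_nonneg dist_nonneg hs'.le) (div_nonneg dist_nonneg hs.le)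
      (div_le_div_of_nonneg_left dist_nonneg hs hss')

/-- The kernel linkage `𝕃^K(X)`, sending `(s,t,k)` to the single-linkage clustering of the
subspace `X_{[s,k]}` at scale `t`. -/
def kernelLinkage (K : DensityKernel) (μ : Measure X) [IsFiniteMeasure μ] :
    HierarchicalClustering₃ X where
  toFun p := Clustering.ofSubset (kernelFiltration K μ p.1.1 (OrderDual.ofDual p.2.2).1)
    (singleLinkage _ p.2.1)
  monotone' := by
    rintro ⟨s, t, k⟩ ⟨s', t', k'⟩ ⟨hs, ht, hk⟩ _ ⟨_, ⟨y, rfl⟩, rfl⟩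
    have hsub : kernelFiltration K μ s.1 (OrderDual.ofDual k).1 ⊆
        kernelFiltration K μ s'.1 (OrderDual.ofDual k').1 := kernelFiltration_mono K μ s.2 hs hk
    refine ⟨_, ⟨_, ⟨Set.inclusion hsub y, rfl⟩, rfl⟩, ?_⟩
    rintro _ ⟨x, hx, rfl⟩
    refine ⟨Set.inclusion hsub x, ?_, rfl⟩
    have hx' : Relation.EqvGen (fun a b => dist a b ≤ t.1) x y := hx
    change Relation.EqvGen (fun a b => dist a b ≤ t'.1) (Set.inclusion hsub x)
      (Set.inclusion hsub y)
    clear hx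
    induction hx' with
    | rel a b hab => exact .rel _ _ (le_trans (show dist a b ≤ t.1 from hab) ht)
    | refl a => exact .refl _
    | symm a b _ ih => exact .symm _ _ ih
    | trans a b c _ _ ih₁ ih₂ => exact .trans _ _ _ ih₁ ih₂

end KernelLinkage

/-- A curve in the `(1,1,-1)`-parameter space, defined on the interval `(0, max)` with
`0 < max ≤ ∞`. Only the values of `s`, `t`, `k` on that interval matter. -/
structure ParamCurve where
  max : EReal
  max_pos : 0 < max
  s : ℝ → ℝ
  t : ℝ → ℝ
  k : ℝ → ℝ
  s_pos : ∀ r : ℝ, 0 < r → r < max → 0 < s r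
  t_pos : ∀ r : ℝ, 0 < r → r < max → 0 < t r
  k_pos : ∀ r : ℝ, 0 < r → r < max → 0 < k r
  s_cont : ContinuousOn s {r : ℝ | 0 < r ∧ r < max}
  t_cont : ContinuousOn t {r : ℝ | 0 < r ∧ r < max}
  k_cont : ContinuousOn k {r : ℝ | 0 < r ∧ r < max}
  s_anti : AntitoneOn s {r : ℝ | 0 < r ∧ r < max}
  t_anti : AntitoneOn t {r : ℝ | 0 < r ∧ r < max}
  k_mono : MonotoneOn k {r : ℝ | 0 < r ∧ r < max}

namespace ParamCurve

/-- The interval `I_γ = (0, max_γ)`. -/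
def dom (γ : ParamCurve) : Set ℝ := {r : ℝ | 0 < r ∧ r < γ.max}

open Classical in
/-- The slice `H^γ`: `H(γ(r))` for `r ∈ I_γ`, and the empty clustering for `r ≥ max_γ`. -/
def slice {X : Type*} (γ : ParamCurve) (H : HierarchicalClustering₃ X) :
    HierarchicalClustering X where
  toFun r :=
    if h : ((OrderDual.ofDual r).1 : EReal) < γ.max then
      H (⟨γ.s (OrderDual.ofDual r).1, γ.s_pos _ (OrderDual.ofDual r).2 h⟩,
        ⟨γ.t (OrderDual.ofDual r).1, γ.t_pos _ (OrderDual.ofDual r).2 h⟩,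
        OrderDual.toDual ⟨γ.k (OrderDual.ofDual r).1, γ.k_pos _ (OrderDual.ofDual r).2 h⟩)
    else Clustering.empty X
  monotone' := by
    intro r r' hrr'
    have hle : (OrderDual.ofDual r').1 ≤ (OrderDual.ofDual r).1 := hrr'
    by_cases h : ((OrderDual.ofDual r).1 : EReal) < γ.max
    · have h' : ((OrderDual.ofDual r').1 : EReal) < γ.max :=
        lt_of_le_of_lt (EReal.coe_le_coe_iff.2 hle) h
      simp only [h, h', dif_pos]
      have m : (OrderDual.ofDual r).1 ∈ γ.dom := ⟨(OrderDual.ofDual r).2, h⟩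
      have m' : (OrderDual.ofDual r').1 ∈ γ.dom := ⟨(OrderDual.ofDual r').2, h'⟩
      exact H.monotone ⟨γ.s_anti m' m hle, γ.t_anti m' m hle, γ.k_mono m' m hle⟩
    · simp only [h, dif_neg, not_false_eq_true]
      exact Clustering.empty_le _

/-- Covering curves. The filter `atTop` on the open interval `I_γ` is `r → max_γ`. -/
structure Covering (γ : ParamCurve) : Prop where
  s_strictAnti : StrictAntiOn γ.s γ.dom
  s_tendsto : Tendsto (fun r : γ.dom => γ.s r) atTop (𝓝 0)
  k_strictMono : StrictMonoOn γ.k γ.dom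
  k_tendsto : Tendsto γ.k (𝓝[>] 0) (𝓝 0)

/-- Curves that are non-singular in each component. -/
structure NonSingular (γ : ParamCurve) : Prop where
  s_contDiff : ContDiffOn ℝ 1 γ.s γ.dom
  t_contDiff : ContDiffOn ℝ 1 γ.t γ.dom
  k_contDiff : ContDiffOn ℝ 1 γ.k γ.dom
  s_deriv : ∀ r ∈ γ.dom, deriv γ.s r < 0
  t_deriv : ∀ r ∈ γ.dom, deriv γ.t r < 0
  k_deriv : ∀ r ∈ γ.dom, 0 < deriv γ.k r

end ParamCurve

/-- Admissible families of curves. -/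
structure AdmissibleFamily {Θ : Type*} (γ : Θ → ParamCurve) : Prop where
  covering : ∀ θ, (γ θ).Covering
  nonSingular : ∀ θ, (γ θ).NonSingular
  small : ∀ b : ℝ, 0 < b → ∃ θ, ∀ r ∈ (γ θ).dom, (γ θ).s r < b ∧ (γ θ).t r < b

/-- Euclidean space `ℝ^d`. -/
abbrev E (d : ℕ) : Type := EuclideanSpace ℝ (Fin d)

/-- `v_s = ∫_{ℝ^d} K(‖x‖/s) dx`. -/
def kernelVolume (d : ℕ) (K : DensityKernel) (s : ℝ) : ℝ := ∫ x : E d, K (‖x‖ / s)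

/-- `v_1 < ∞` (equivalently `v_s < ∞` for all `s > 0`); automatic for `d = 1`. -/
def DensityKernel.FiniteVolume (d : ℕ) (K : DensityKernel) : Prop :=
  Integrable fun x : E d => K ‖x‖

theorem kernelVolume_eq (d : ℕ) (K : DensityKernel) {s : ℝ} (hs : 0 < s) :
    kernelVolume d K s = s ^ d * kernelVolume d K 1 := by
  have h := Measure.integral_comp_inv_smul_of_nonneg (volume : Measure (E d))
    (fun x => K ‖x‖) hs.le
  simp only [finrank_euclideanSpace, Fintype.card_fin, smul_eq_mul] at h
  simp only [kernelVolume, div_one]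
  rw [← h]
  refine integral_congr_ae (ae_of_all _ fun x => ?_)
  simp only [norm_smul, norm_inv, Real.norm_of_nonneg hs.le]
  rw [div_eq_inv_mul]

theorem DensityKernel.zero_pos (K : DensityKernel) : 0 < K 0 := by
  by_contra h
  have h0 : ∀ r ∈ Ioi (0 : ℝ), K r = 0 := fun r (hr : 0 < r) =>
    le_antisymm ((K.antitoneOn (mem_Ici.2 le_rfl) hr.le hr.le).trans (not_lt.1 h))
      (K.nonneg r hr.le)
  have h1 := K.integral_pos
  rw [setIntegral_congr_fun measurableSet_Ioi h0] at h1
  simp at h1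

theorem kernelVolume_one_pos {d : ℕ} {K : DensityKernel} (hK : K.FiniteVolume d) :
    0 < kernelVolume d K 1 := by
  simp only [kernelVolume, div_one]
  rw [integral_pos_iff_support_of_nonneg (fun x => K.nonneg _ (norm_nonneg x)) hK]
  have h1 : ∀ᶠ r in 𝓝[≥] (0 : ℝ), 0 < K r :=
    (K.rightContinuous 0 le_rfl).eventually (lt_mem_nhds K.zero_pos)
  have h2 : Tendsto (fun x : E d => ‖x‖) (𝓝 0) (𝓝[≥] (0 : ℝ)) := by
    refine tendsto_nhdsWithin_iff.2 ⟨?_, Eventually.of_forall fun x => norm_nonneg x⟩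
    simpa using (continuous_norm (E := E d)).tendsto 0
  refine Measure.measure_pos_of_mem_nhds volume (x := 0) ?_
  filter_upwards [h2.eventually h1] with x hx using hx.ne'

theorem kernelVolume_pos {d : ℕ} {K : DensityKernel} (hK : K.FiniteVolume d) {s : ℝ}
    (hs : 0 < s) : 0 < kernelVolume d K s := by
  rw [kernelVolume_eq d K hs]
  exact mul_pos (pow_pos hs d) (kernelVolume_one_pos hK)

namespace ParamCurve

/-- `φ(r) = γ_k(r) / v_{γ_s(r)}`. -/
def phi (γ : ParamCurve) (d : ℕ) (K : DensityKernel) (r : ℝ) : ℝ :=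
  γ.k r / kernelVolume d K (γ.s r)

variable {γ : ParamCurve} {d : ℕ} {K : DensityKernel}

theorem dom_lt_mem {r r' : ℝ} (hr : r ∈ γ.dom) (h0 : 0 < r') (h : r' ≤ r) : r' ∈ γ.dom :=
  ⟨h0, lt_of_le_of_lt (EReal.coe_le_coe_iff.2 h) hr.2⟩

theorem ordConnected_dom : γ.dom.OrdConnected :=
  ⟨fun _ hx _ hy _ hz => dom_lt_mem hy (lt_of_lt_of_le hx.1 hz.1) hz.2⟩

theorem dom_nonempty : γ.dom.Nonempty := by
  obtain ⟨r, h0, h1⟩ := EReal.lt_iff_exists_real_btwn.1 γ.max_pos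
  exact ⟨r, by exact_mod_cast h0, h1⟩

theorem phi_pos (hK : K.FiniteVolume d) {r : ℝ} (hr : r ∈ γ.dom) : 0 < γ.phi d K r :=
  div_pos (γ.k_pos r hr.1 hr.2) (kernelVolume_pos hK (γ.s_pos r hr.1 hr.2))

theorem phi_strictMonoOn (hγ : γ.Covering) (hK : K.FiniteVolume d) :
    StrictMonoOn (γ.phi d K) γ.dom := by
  intro a ha b hb hab
  have hsa := γ.s_pos a ha.1 ha.2
  have hsb := γ.s_pos b hb.1 hb.2
  refine div_lt_div₀ (hγ.k_strictMono ha hb hab) ?_ (γ.k_pos b hb.1 hb.2).le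
    (kernelVolume_pos hK hsb)
  rw [kernelVolume_eq d K hsa, kernelVolume_eq d K hsb]
  exact mul_le_mul_of_nonneg_right (pow_le_pow_left₀ hsb.le (γ.s_anti ha hb hab.le) d)
    (kernelVolume_one_pos hK).le

theorem phi_continuousOn (hK : K.FiniteVolume d) : ContinuousOn (γ.phi d K) γ.dom := by
  have h : ContinuousOn (fun r => γ.k r / (γ.s r ^ d * kernelVolume d K 1)) γ.dom := by
    refine ContinuousOn.div γ.k_cont ((γ.s_cont.pow d).mul continuousOn_const) fun r hr => ?_
    exact (mul_pos (pow_pos (γ.s_pos r hr.1 hr.2) d) (kernelVolume_one_pos hK)).ne'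
  refine h.congr fun r hr => ?_
  simp only [phi]
  rw [kernelVolume_eq d K (γ.s_pos r hr.1 hr.2)]

theorem phi_surjOn (hd : 0 < d) (hγ : γ.Covering) (hK : K.FiniteVolume d) :
    SurjOn (γ.phi d K) γ.dom (Ioi 0) := by
  intro y hy
  have hy : 0 < y := hy
  have hv := kernelVolume_one_pos hK
  obtain ⟨r₀, hr₀⟩ := γ.dom_nonempty
  have hs₀ := γ.s_pos r₀ hr₀.1 hr₀.2
  have hk₀ := γ.k_pos r₀ hr₀.1 hr₀.2
  have hlow : ∃ a ∈ γ.dom, γ.phi d K a ≤ y := by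
    have h1 : ∀ᶠ r in 𝓝[>] (0 : ℝ), γ.k r < y * kernelVolume d K (γ.s r₀) :=
      hγ.k_tendsto.eventually (gt_mem_nhds (mul_pos hy (kernelVolume_pos hK hs₀)))
    have h2 : ∀ᶠ r in 𝓝[>] (0 : ℝ), r ∈ Ioo 0 r₀ := Ioo_mem_nhdsGT hr₀.1
    obtain ⟨a, ha1, ha2⟩ := (h1.and h2).exists
    have ha := dom_lt_mem hr₀ ha2.1 ha2.2.le
    have hsa := γ.s_pos a ha.1 ha.2
    refine ⟨a, ha, (div_le_iff₀ (kernelVolume_pos hK hsa)).2 (ha1.le.trans ?_)⟩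
    refine mul_le_mul_of_nonneg_left ?_ hy.le
    rw [kernelVolume_eq d K hsa, kernelVolume_eq d K hs₀]
    exact mul_le_mul_of_nonneg_right (pow_le_pow_left₀ hs₀.le (γ.s_anti ha hr₀ ha2.2.le) d) hv.le
  have hhigh : ∃ b ∈ γ.dom, y ≤ γ.phi d K b := by
    have : Nonempty γ.dom := ⟨⟨r₀, hr₀⟩⟩
    have h1 : Tendsto (fun r : γ.dom => y * (γ.s r ^ d * kernelVolume d K 1)) atTop (𝓝 0) := by
      have := ((hγ.s_tendsto.pow d).mul_const (kernelVolume d K 1)).const_mul y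
      simpa [hd.ne'] using this
    have h2 := h1.eventually (gt_mem_nhds hk₀)
    obtain ⟨b, hb1, hb2⟩ := (h2.and (eventually_ge_atTop (⟨r₀, hr₀⟩ : γ.dom))).exists
    have hsb := γ.s_pos b.1 b.2.1 b.2.2
    refine ⟨b, b.2, (le_div_iff₀ (kernelVolume_pos hK hsb)).2 ?_⟩
    rw [kernelVolume_eq d K hsb]
    exact hb1.le.trans (γ.k_mono hr₀ b.2 hb2)
  obtain ⟨a, ha, hay⟩ := hlow
  obtain ⟨b, hb, hby⟩ := hhigh
  exact (ordConnected_dom.isPreconnected).intermediate_value ha hb (phi_continuousOn hK)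
    ⟨hay, hby⟩

/-- The inverse of the bijection `φ : I_γ → (0, ∞)`. -/
def phiInv (γ : ParamCurve) (d : ℕ) (K : DensityKernel) : ℝ → ℝ :=
  Function.invFunOn (γ.phi d K) γ.dom

theorem phiInv_mem (hd : 0 < d) (hγ : γ.Covering) (hK : K.FiniteVolume d) {y : ℝ} (hy : 0 < y) :
    γ.phiInv d K y ∈ γ.dom := Function.invFunOn_mem (phi_surjOn hd hγ hK hy)

theorem phi_phiInv (hd : 0 < d) (hγ : γ.Covering) (hK : K.FiniteVolume d) {y : ℝ} (hy : 0 < y) :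
    γ.phi d K (γ.phiInv d K y) = y := Function.invFunOn_eq (phi_surjOn hd hγ hK hy)

theorem phiInv_strictMonoOn (hd : 0 < d) (hγ : γ.Covering) (hK : K.FiniteVolume d) :
    StrictMonoOn (γ.phiInv d K) (Ioi 0) := by
  intro a ha b hb hab
  rw [← (phi_strictMonoOn hγ hK).lt_iff_lt (phiInv_mem hd hγ hK ha) (phiInv_mem hd hγ hK hb),
    phi_phiInv hd hγ hK ha, phi_phiInv hd hγ hK hb]
  exact hab

theorem phiInv_image (hd : 0 < d) (hγ : γ.Covering) (hK : K.FiniteVolume d) :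
    γ.phiInv d K '' Ioi 0 = γ.dom := by
  refine Subset.antisymm ?_ fun r hr => ⟨γ.phi d K r, phi_pos hK hr, ?_⟩
  · rintro _ ⟨y, hy, rfl⟩
    exact phiInv_mem hd hγ hK hy
  · exact (phi_strictMonoOn hγ hK).injOn (phiInv_mem hd hγ hK (phi_pos hK hr)) hr
      (phi_phiInv hd hγ hK (phi_pos hK hr))

theorem isOpen_dom : IsOpen γ.dom :=
  isOpen_Ioi.inter (isOpen_Iio.preimage continuous_coe_real_ereal)

theorem phiInv_continuousOn (hd : 0 < d) (hγ : γ.Covering) (hK : K.FiniteVolume d) :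
    ContinuousOn (γ.phiInv d K) (Ioi 0) := by
  intro y hy
  refine ContinuousAt.continuousWithinAt ?_
  refine (phiInv_strictMonoOn hd hγ hK).continuousAt_of_image_mem_nhds (Ioi_mem_nhds hy) ?_
  rw [phiInv_image hd hγ hK]
  exact isOpen_dom.mem_nhds (phiInv_mem hd hγ hK hy)

/-- The reparametrized curve `γ̄ = γ ∘ φ⁻¹`, defined on `(0, ∞)`. -/
def reparam (γ : ParamCurve) {d : ℕ} (hd : 0 < d) (hγ : γ.Covering) {K : DensityKernel}
    (hK : K.FiniteVolume d) : ParamCurve where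
  max := ⊤
  max_pos := EReal.zero_lt_top
  s := γ.s ∘ γ.phiInv d K
  t := γ.t ∘ γ.phiInv d K
  k := γ.k ∘ γ.phiInv d K
  s_pos _ h _ := γ.s_pos _ (phiInv_mem hd hγ hK h).1 (phiInv_mem hd hγ hK h).2
  t_pos _ h _ := γ.t_pos _ (phiInv_mem hd hγ hK h).1 (phiInv_mem hd hγ hK h).2
  k_pos _ h _ := γ.k_pos _ (phiInv_mem hd hγ hK h).1 (phiInv_mem hd hγ hK h).2
  s_cont := γ.s_cont.comp ((phiInv_continuousOn hd hγ hK).mono fun _ h => h.1)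
    fun _ h => phiInv_mem hd hγ hK h.1
  t_cont := γ.t_cont.comp ((phiInv_continuousOn hd hγ hK).mono fun _ h => h.1)
    fun _ h => phiInv_mem hd hγ hK h.1
  k_cont := γ.k_cont.comp ((phiInv_continuousOn hd hγ hK).mono fun _ h => h.1)
    fun _ h => phiInv_mem hd hγ hK h.1
  s_anti _ ha _ hb hab := γ.s_anti (phiInv_mem hd hγ hK ha.1) (phiInv_mem hd hγ hK hb.1)
    ((phiInv_strictMonoOn hd hγ hK).monotoneOn ha.1 hb.1 hab)
  t_anti _ ha _ hb hab := γ.t_anti (phiInv_mem hd hγ hK ha.1) (phiInv_mem hd hγ hK hb.1)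
    ((phiInv_strictMonoOn hd hγ hK).monotoneOn ha.1 hb.1 hab)
  k_mono _ ha _ hb hab := γ.k_mono (phiInv_mem hd hγ hK ha.1) (phiInv_mem hd hγ hK hb.1)
    ((phiInv_strictMonoOn hd hγ hK).monotoneOn ha.1 hb.1 hab)

end ParamCurve

/-- The normalized counting measure of a finite space (the zero measure on the empty space). -/
def normalizedCount (X : Type*) [MeasurableSpace X] : Measure X :=
  (Nat.card X : ENNReal)⁻¹ • Measure.count

instance (X : Type*) [MeasurableSpace X] [MeasurableSingletonClass X] [Finite X] :
    IsFiniteMeasure (normalizedCount X) := by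
  constructor
  rcases isEmpty_or_nonempty X with h | h
  · simp [Set.eq_empty_of_isEmpty (Set.univ : Set X)]
  · have h1 : (Nat.card X : ENNReal) ≠ 0 := by
      exact_mod_cast Nat.card_pos.ne'
    simp only [normalizedCount, Measure.smul_apply, smul_eq_mul]
    exact ENNReal.mul_lt_top (ENNReal.inv_lt_top.2 (pos_iff_ne_zero.2 h1))
      (Measure.count_apply_lt_top.2 Set.finite_univ)

/-- A hierarchical clustering algorithm with parameter space `Θ` assigns a hierarchical clustering
to each parameter and each finite metric space (carrying its Borel σ-algebra). -/
abbrev HCAlgorithm (Θ : Type*) : Type _ :=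
  Θ → ∀ (X : Type) [MetricSpace X] [Finite X] [MeasurableSpace X] [BorelSpace X],
    HierarchicalClustering X

/-- The algorithm `γ̄`-linkage: a finite metric space, with its normalized counting measure, is sent
to the slice of its kernel linkage by the reparametrized curve `γ̄^θ`. -/
def gammaBarLinkage {Θ : Type*} {d : ℕ} (hd : 0 < d) {K : DensityKernel} (hK : K.FiniteVolume d)
    (γ : Θ → ParamCurve) (hγ : AdmissibleFamily γ) : HCAlgorithm Θ :=
  fun θ X _ _ _ _ =>
    ((γ θ).reparam hd (hγ.covering θ) hK).slice (kernelLinkage K (normalizedCount X))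

/-- Probability density functions on `ℝ^d`. -/
structure IsProbabilityDensity {d : ℕ} (f : E d → ℝ) : Prop where
  nonneg : ∀ x, 0 ≤ f x
  integrable : Integrable f
  integral_eq_one : ∫ x, f x = 1

/-- The measure `μ_f` on `supp(f)` with density `f`. -/
def densityMeasure {d : ℕ} (f : E d → ℝ) : Measure (tsupport f) :=
  (volume.withDensity fun x => ENNReal.ofReal (f x)).comap Subtype.val

/-- The density-contour hierarchical clustering `H(f)` of `supp(f)`: at scale `r` the connected
components of `{x ∈ supp(f) : f(x) ≥ r}`. -/
def densityContour {d : ℕ} (f : E d → ℝ) : HierarchicalClustering (tsupport f) where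
  toFun r :=
    { clusters := {C | ∃ x ∈ {z : tsupport f | (OrderDual.ofDual r).1 ≤ f z},
        C = connectedComponentIn {z : tsupport f | (OrderDual.ofDual r).1 ≤ f z} x}
      nonempty := by
        rintro _ ⟨x, hx, rfl⟩
        exact ⟨x, mem_connectedComponentIn hx⟩
      disjoint := by
        rintro _ ⟨x, hx, rfl⟩ _ ⟨y, hy, rfl⟩ hne
        refine Set.disjoint_left.2 fun z hzx hzy => hne ?_
        rw [connectedComponentIn_eq hzx, connectedComponentIn_eq hzy] }
  monotone' := by
    rintro r r' h _ ⟨x, hx, rfl⟩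
    have hle : (OrderDual.ofDual r').1 ≤ (OrderDual.ofDual r).1 := h
    exact ⟨_, ⟨x, hle.trans hx, rfl⟩,
      connectedComponentIn_mono x fun z hz => hle.trans hz⟩

/-- The algorithm `𝔸` is MI-consistent with respect to `f`. The sample is a point `x` of
`supp(f)^n` under the product measure `μ_f^{⊗n}`; `X_n` is the set of its values, with the subspace
metric and the normalized counting measure. That the probability of being
`ε`-measured-interleaved tends to `1` is expressed by the (outer) probability of the complementary
event tending to `0`, so that no measurability of the event is presupposed. -/
def MIConsistent {Θ : Type*} {d : ℕ} (𝔸 : HCAlgorithm Θ) (f : E d → ℝ) : Prop :=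
  ∃ θ : ℕ → Θ, ∀ ε : ℝ, 0 < ε →
    Tendsto (fun n : ℕ =>
      (Measure.pi fun _ : Fin n => densityMeasure f)
        {x : Fin n → tsupport f | ¬ MeasuredInterleavedWrt
          (normalizedCount (Set.range x)) (densityMeasure f)
          (𝔸 (θ n) (Set.range x)) (densityContour f)
          (closestPointCorrespondence (fun p : Set.range x => (p.1 : E d))
            (fun y : tsupport f => (y : E d))) ε ε})
      atTop (𝓝 0)

end GammaLinkage

end

noncomputable section

namespace GammaLinkage

/-! ### Clusters of single linkage on a subset -/

section Linkage

variable {X : Type*} [MetricSpace X] {U : Set X} {t : PosReal} {A : Set X}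

/-! The reparametrization makes `γ̄_k(r) = r · v_s` with `s = γ̄_s(r)` (`reparam_k_eq`), so a sample
point survives in the filtration at scale `r` exactly when its kernel density estimate, divided by
`v_s`, is at least `r`. If that normalized estimate is uniformly within `ε/4` of `f`, the filtration
is squeezed between superlevel sets of `f`. Linkage clusters then lie in contour components, because
steps of length at most `t` barely change `f`; contour components lie in linkage clusters, because
the sample is dense compared with `t`. Measures are compared by a Prokhorov-type estimate. This
deterministic argument is `measuredInterleavedWrt_densityContour`.

All its probabilistic input comes from one event. Approximate the identity of the compact support by
a simple map `q` moving points by at most `ρ`. There are finitely many cells, so Chebyshev and a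
union bound give, with probability tending to `1`, that the empirical means of all functions `g ∘ q`
with `0 ≤ g ≤ 1` are within `κ` of their expectations (`tendsto_pi_not_uniform_mean`). On this
event, for samples without repetitions, one gets density of the sample (`exists_sample_dist_le`),
both Prokhorov inequalities, and the uniform density estimate (`abs_mean_kernel_sub_le`).

Order of choices: `ε` fixes a bound `b` on bandwidth and linkage scale, controlling smoothing bias
and oscillation of `f`; admissibility gives `θ`. Only scales between about `ε/2` and `M + 1`, with
`f ≤ M`, matter, and there the curve's `s` and `t` are at least their values at `M + 1`. Hence `ρ`
and `κ` can be chosen from `θ`, and then `n → ∞`. A diagonal choice makes `θ` depend on `n` alone.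
-/

theorem Clustering.linkage_subset (hA : A ∈ (Clustering.ofSubset U (singleLinkage U t)).clusters) :
    A ⊆ U := by
  obtain ⟨A, -, rfl⟩ := hA
  rintro _ ⟨x, -, rfl⟩
  exact x.2

theorem Clustering.mem_linkage_of_dist_le
    (hA : A ∈ (Clustering.ofSubset U (singleLinkage U t)).clusters) {p q : X} (hp : p ∈ A)
    (hq : q ∈ U) (h : dist p q ≤ t.1) : q ∈ A := by
  obtain ⟨_, ⟨y, rfl⟩, rfl⟩ := hA
  obtain ⟨p, hp, rfl⟩ := hp
  refine ⟨⟨q, hq⟩, ?_, rfl⟩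
  exact .trans _ _ _ (.symm _ _ (.rel p ⟨q, hq⟩ h)) hp

theorem Clustering.exists_mem_linkage {p : X} (hp : p ∈ U) :
    ∃ A ∈ (Clustering.ofSubset U (singleLinkage U t)).clusters, p ∈ A :=
  ⟨_, ⟨_, ⟨⟨p, hp⟩, rfl⟩, rfl⟩, ⟨⟨p, hp⟩, .refl _, rfl⟩⟩

/-- Membership in a set closed under steps of length at most `t` is constant along chains of such
steps. -/
theorem Clustering.linkage_induction
    (hA : A ∈ (Clustering.ofSubset U (singleLinkage U t)).clusters) {S : Set X} {p : X}
    (hp : p ∈ A) (hpS : p ∈ S) (h : ∀ a ∈ U, ∀ b ∈ U, dist a b ≤ t.1 → a ∈ S → b ∈ S) :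
    A ⊆ S := by
  obtain ⟨_, ⟨y, rfl⟩, rfl⟩ := hA
  obtain ⟨p, hp, rfl⟩ := hp
  have key : ∀ a b : U, Relation.EqvGen (fun a b : U => dist a b ≤ t.1) a b →
      (a.1 ∈ S ↔ b.1 ∈ S) := by
    intro a b hab
    induction hab with
    | rel a b hab =>
      exact ⟨h a a.2 b b.2 hab, h b b.2 a a.2 (by rw [dist_comm]; exact hab)⟩
    | refl a => rfl
    | symm a b _ ih => exact ih.symm
    | trans a b c _ _ ih₁ ih₂ => exact ih₁.trans ih₂
  rintro _ ⟨z, hz, rfl⟩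
  exact ((key z y hz).trans (key p y hp).symm).2 hpS

end Linkage

/-! ### Components of superlevel sets -/

section Contour

variable {d : ℕ} {f : E d → ℝ}

/-- The segment stays inside the support because `f ≥ r > 0` on it, so it is a connected piece of
the superlevel set. -/
theorem mem_densityContour_of_segment {r : ℝ} (hr : 0 < r) {B : Set (tsupport f)}
    (hB : B ∈ ((densityContour f).at' r hr).clusters) {x y : tsupport f} (hx : x ∈ B)
    (h : ∀ z ∈ segment ℝ (x : E d) y, r ≤ f z) : y ∈ B := by
  obtain ⟨z, hz, rfl⟩ := hB
  rw [connectedComponentIn_eq hx]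
  have hsub : segment ℝ (x : E d) y ⊆ tsupport f := fun z hz =>
    subset_tsupport f (Function.mem_support.2 (hr.trans_le (h z hz)).ne')
  have hpre : IsPreconnected ((Subtype.val : tsupport f → E d) ⁻¹' segment ℝ (x : E d) y) := by
    rw [← Topology.IsInducing.subtypeVal.isPreconnected_image, Subtype.image_preimage_coe,
      inter_eq_right.2 hsub]
    exact (convex_segment _ _).isPreconnected
  exact hpre.subset_connectedComponentIn (left_mem_segment ℝ _ _) (fun w hw => h w hw)
    (right_mem_segment ℝ (x : E d) y)

theorem densityContour_subset {r : ℝ} {hr : 0 < r} {B : Set (tsupport f)}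
    (hB : B ∈ ((densityContour f).at' r hr).clusters) {x : tsupport f} (hx : x ∈ B) :
    r ≤ f x := by
  obtain ⟨z, hz, rfl⟩ := hB
  exact connectedComponentIn_subset {z : tsupport f | r ≤ f z} z hx

theorem exists_mem_densityContour {r : ℝ} (hr : 0 < r) {x : tsupport f} (hx : r ≤ f x) :
    ∃ B ∈ ((densityContour f).at' r hr).clusters, x ∈ B :=
  ⟨_, ⟨x, hx, rfl⟩, mem_connectedComponentIn (F := {z : tsupport f | r ≤ f z}) hx⟩

theorem densityContour_isPreconnected {r : ℝ} {hr : 0 < r} {B : Set (tsupport f)}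
    (hB : B ∈ ((densityContour f).at' r hr).clusters) : IsPreconnected B := by
  obtain ⟨z, hz, rfl⟩ := hB
  exact isPreconnected_connectedComponentIn

/-- Components of a closed set are closed, since the closure of a connected set is connected. -/
theorem densityContour_isMeasurable (hf : Continuous f) : (densityContour f).IsMeasurable := by
  rintro r hr _ ⟨z, hz, rfl⟩
  have hcl : IsClosed {z : tsupport f | r ≤ f z} :=
    isClosed_le continuous_const (hf.comp continuous_subtype_val)
  have hsub : closure (connectedComponentIn {z : tsupport f | r ≤ f z} z) ⊆
      connectedComponentIn {z : tsupport f | r ≤ f z} z :=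
    isPreconnected_connectedComponentIn.closure.subset_connectedComponentIn
      (subset_closure (mem_connectedComponentIn hz))
      (closure_minimal (connectedComponentIn_subset _ _) hcl)
  exact (isClosed_of_closure_subset hsub).measurableSet

end Contour

/-! ### Monotonicity in the interleaving parameters -/

section Mono

variable {X Y : Type*}

theorem HierarchicalClustering.at'_le_at' (H : HierarchicalClustering X) {r r' : ℝ} (hr : 0 < r)
    (hr' : 0 < r') (h : r ≤ r') : H.at' r' hr' ≤ H.at' r hr :=
  H.monotone (show OrderDual.toDual (⟨r', hr'⟩ : PosReal) ≤ OrderDual.toDual ⟨r, hr⟩ from h)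

theorem HierarchicalClustering.Interleaved.mono {H E : HierarchicalClustering X} {ε ε' : ℝ}
    (h : H.Interleaved E ε) (hε : ε ≤ ε') : H.Interleaved E ε' := by
  intro r hr hrε
  have h1 : 0 < r - ε := by linarith
  have h2 : r - ε' ≤ r - ε := by linarith
  exact ⟨(h r hr h1).1.trans (E.at'_le_at' hrε h1 h2), (h r hr h1).2.trans (H.at'_le_at' hrε h1 h2)⟩

/-- The transported cluster at the smaller shift lies in the one at the larger shift. -/
theorem exists_transports_subset {H : HierarchicalClustering X} {E : HierarchicalClustering Y}
    {R : Set (X × Y)} (hR : ∀ x, ∃ y, (x, y) ∈ R) {ε ε' r : ℝ} (hε : ε ≤ ε') (hr : 0 < r)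
    (hrε : 0 < r - ε) (hrε' : 0 < r - ε')
    (h : (HierarchicalClustering.pullback (fun p : R => p.1.1) H).at' r hr ≤
      (HierarchicalClustering.pullback (fun p : R => p.1.2) E).at' (r - ε) hrε)
    {A : Set X} {B : Set Y} (hA : A ∈ (H.at' r hr).clusters)
    (hB : B ∈ (E.at' (r - ε') hrε').clusters) (hAB : Transports R A B) :
    ∃ C ∈ (E.at' (r - ε) hrε).clusters, Transports R A C ∧ C ⊆ B := by
  obtain ⟨x, hx⟩ := (H.at' r hr).nonempty A hA
  obtain ⟨y, hxy⟩ := hR x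
  obtain ⟨_, ⟨-, C, hC, rfl⟩, hAC⟩ := h ((fun p : R => p.1.1) ⁻¹' A)
    ⟨⟨⟨(x, y), hxy⟩, hx⟩, A, hA, rfl⟩
  have hAC' : Transports R A C := fun p hp hpA => @hAC ⟨p, hp⟩ hpA
  obtain ⟨B', hB', hCB'⟩ := E.at'_le_at' hrε' hrε (by linarith) C hC
  have hyC := hAC' (x, y) hxy hx
  obtain rfl := Clustering.eq_of_mem _ hB hB' (hAB (x, y) hxy hx) (hCB' hyC)
  exact ⟨C, hC, hAC', hCB'⟩

/-- A larger shift lowers the target scale and so enlarges the transported clusters, which only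
helps the measure inequalities. This lets an interleaving at a vanishing parameter serve every fixed
`ε`. -/
theorem MeasuredInterleavedWrt.mono [MeasurableSpace X] [MeasurableSpace Y]
    {μ : Measure X} {ν : Measure Y} {H : HierarchicalClustering X} {E : HierarchicalClustering Y}
    {R : Set (X × Y)} {ε ε' m m' : ℝ} (h : MeasuredInterleavedWrt μ ν H E R ε m)
    (hε : ε ≤ ε') (hm : m ≤ m') : MeasuredInterleavedWrt μ ν H E R ε' m' := by
  obtain ⟨hH, hE, ⟨hR, hI⟩, hmeas⟩ := h
  refine ⟨hH, hE, ⟨hR, hI.mono hε⟩, fun r hr hrε' N => ?_⟩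
  have hrε : 0 < r - ε := by linarith
  refine ⟨fun A B hA hB hAB => ?_, fun B A hB hA hBA => ?_⟩
  · choose C hC hAC hCB using fun i =>
      exists_transports_subset hR.1 hε hr hrε hrε' (hI r hr hrε).1 (hA i) (hB i) (hAB i)
    exact ((hmeas r hr hrε N).1 A C hA hC hAC).trans
      (add_le_add (measure_mono (iUnion_mono hCB)) (ENNReal.ofReal_le_ofReal hm))
  -- The reverse direction is the same argument for the flipped correspondence.
  · have hI' : (HierarchicalClustering.pullback
        (fun p : (Prod.swap ⁻¹' R : Set (Y × X)) => p.1.1) E).at' r hr ≤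
        (HierarchicalClustering.pullback
          (fun p : (Prod.swap ⁻¹' R : Set (Y × X)) => p.1.2) H).at' (r - ε) hrε := by
      rintro _ ⟨⟨z, hz⟩, D, hD, rfl⟩
      obtain ⟨_, ⟨-, C, hC, rfl⟩, hDC⟩ := (hI r hr hrε).2 ((fun p : R => p.1.2) ⁻¹' D)
        ⟨⟨⟨z.1.swap, z.2⟩, hz⟩, D, hD, rfl⟩
      have hDC' : ∀ w : (Prod.swap ⁻¹' R : Set (Y × X)), w.1.1 ∈ D → w.1.2 ∈ C :=
        fun w hw => @hDC ⟨w.1.swap, w.2⟩ hw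
      refine ⟨_, ⟨⟨z, ?_⟩, C, hC, rfl⟩, ?_⟩
      · exact hDC' z hz
      · exact hDC'
    choose C hC hBC hCA using fun i =>
      exists_transports_subset (R := Prod.swap ⁻¹' R) hR.2 hε hr hrε hrε' hI' (hB i) (hA i) (hBA i)
    exact ((hmeas r hr hrε N).2 B C hB hC hBC).trans
      (add_le_add (measure_mono (iUnion_mono hCA)) (ENNReal.ofReal_le_ofReal hm))

end Mono

/-! ### From approximation to interleaving -/

section Interleaving

variable {d : ℕ} {f : E d → ℝ} {X : Set (tsupport f)}

/-- The deterministic part of the consistency proof: a linkage whose filtration approximates the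
superlevel sets of `f`, on a finite set that approximates `supp(f)` in the Hausdorff and the
Prokhorov sense, is measured-interleaved with the density contours. -/
theorem measuredInterleavedWrt_densityContour [Finite X] [Nonempty X]
    (hcont : Continuous f) {M : ℝ} (hM0 : 0 ≤ M) (hM : ∀ x, f x ≤ M)
    (H : HierarchicalClustering X) (U : ℝ → Set X) (t : ℝ → ℝ)
    (ht : ∀ r, 0 < r → 0 < t r)
    (hH : ∀ r (hr : 0 < r), H.at' r hr = Clustering.ofSubset (U r) (singleLinkage _ ⟨t r, ht r hr⟩))
    (htanti : ∀ r r', 0 < r → r ≤ r' → t r' ≤ t r)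
    {μ : Measure X} {ν : Measure (tsupport f)} {ε b ρ : ℝ} (hε : 0 < ε) (hε1 : ε ≤ 1)
    (hmod : ∀ y z : E d, dist y z ≤ b → |f y - f z| ≤ ε / 4)
    (htb : ∀ r, 0 < r → t r ≤ b) (hρ : 0 < ρ) (hρt : 3 * ρ ≤ t (M + 1))
    (hU : ∀ r, ε / 2 ≤ r → r ≤ M + 1 → ∀ p : X,
      (p ∈ U r → r - ε / 4 ≤ f p) ∧ (r + ε / 4 ≤ f p → p ∈ U r))
    (hdense : ∀ y : tsupport f, ∃ p : X, dist y p.1 ≤ ρ)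
    (hprok₁ : ∀ A : Set X, μ A ≤ ν {y | ∃ a ∈ A, dist y a.1 ≤ ρ} + ENNReal.ofReal ε)
    (hprok₂ : ∀ B : Set (tsupport f), ν B ≤ μ {x | ∃ y ∈ B, dist y x.1 ≤ ρ} + ENNReal.ofReal ε) :
    MeasuredInterleavedWrt μ ν H (densityContour f)
      (closestPointCorrespondence (fun p : X => (p.1 : E d)) (fun y : tsupport f => (y : E d)))
      ε ε := by
  set R := closestPointCorrespondence (fun p : X => (p.1 : E d))
    (fun y : tsupport f => (y : E d)) with hR
  have hRdiag : ∀ p : X, (p, p.1) ∈ R := fun p => Or.inl fun y' => by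
    simp
  have hRdist : ∀ p ∈ R, dist p.2 p.1.1 ≤ ρ := by
    rintro ⟨x, y⟩ (h | h)
    · have := h x.1
      simp only [dist_self] at this
      rw [dist_comm]
      exact this.trans hρ.le
    · obtain ⟨x', hx'⟩ := hdense y
      rw [dist_comm] at hx' ⊢
      exact (h x').trans hx'
  have hcorr : IsCorrespondence R := by
    refine ⟨fun x => ⟨x.1, hRdiag x⟩, fun y => ?_⟩
    obtain ⟨x, hx⟩ := Finite.exists_min fun x : X => dist (x.1 : E d) y
    exact ⟨x, Or.inr hx⟩
  have hρb : ρ ≤ b := by linarith [htb (M + 1) (by linarith)]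
  have hseg : ∀ (y z : E d) (c : ℝ), dist y z ≤ b → c + ε / 4 ≤ f y →
      ∀ w ∈ segment ℝ y z, c ≤ f w := by
    intro y z c hyz hc w hw
    have h1 : dist y w ≤ b := by
      have := dist_add_dist_of_mem_segment hw
      linarith [dist_nonneg (x := w) (y := z)]
    linarith [(abs_le.1 (hmod y w h1)).2]
  have hlow : ∀ r (hr : ε < r), ∀ A ∈ (H.at' r (hε.trans hr)).clusters, ∀ p ∈ A,
      r - ε / 4 ≤ f p.1 := by
    intro r hr A hA p hp
    rcases le_or_gt r (M + 1) with h | h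
    · rw [hH] at hA
      exact (hU r (by linarith) h p).1 (Clustering.linkage_subset hA hp)
    -- There are no clusters above `M + 1`: one would lie in a cluster at `M + 1`, forcing `f ≥ M +
    -- 1 - ε/4 > M`.
    · obtain ⟨A', hA', hAA'⟩ := H.monotone
        (show OrderDual.toDual (⟨r, hε.trans hr⟩ : PosReal) ≤
          OrderDual.toDual ⟨M + 1, by linarith⟩ from h.le) A hA
      have hA' : A' ∈ (H.at' (M + 1) (by linarith)).clusters := hA'
      rw [hH] at hA'
      have := (hU (M + 1) (by linarith) le_rfl p).1 (Clustering.linkage_subset hA' (hAA' hp))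
      linarith [hM p.1]
  -- Absorbing the `ρ`-thickening serves twice: corresponding points are `ρ`-close, and the
  -- Prokhorov inequality compares with a `ρ`-thickening.
  have hthick₁ : ∀ r (hr : ε < r), ∀ A ∈ (H.at' r (hε.trans hr)).clusters,
      ∀ B ∈ ((densityContour f).at' (r - ε) (sub_pos.2 hr)).clusters, ∀ a ∈ A, a.1 ∈ B →
      ∀ y, dist y a.1 ≤ ρ → y ∈ B := by
    intro r hr A hA B hB a ha haB y hy
    refine mem_densityContour_of_segment _ hB haB (hseg _ _ _ ?_ ?_)
    · rw [dist_comm]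
      exact hy.trans hρb
    · linarith [hlow r hr A hA a ha]
  have hinter₁ : ∀ r (hr : ε < r), ∀ A ∈ (H.at' r (hε.trans hr)).clusters,
      ∃ B ∈ ((densityContour f).at' (r - ε) (sub_pos.2 hr)).clusters, Transports R A B := by
    intro r hr A hA
    obtain ⟨a, ha⟩ := (H.at' r (hε.trans hr)).nonempty A hA
    obtain ⟨B, hB, haB⟩ := exists_mem_densityContour (f := f) (sub_pos.2 hr) (x := a.1)
      (by linarith [hlow r hr A hA a ha])
    have hAB : A ⊆ {p | p ∈ A ∧ p.1 ∈ B} := by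
      have hA' := hA
      rw [hH] at hA'
      refine Clustering.linkage_induction hA' ha ⟨ha, haB⟩ ?_
      rintro p - q hq hpq ⟨hpA, hpB⟩
      refine ⟨Clustering.mem_linkage_of_dist_le hA' hpA hq hpq,
        mem_densityContour_of_segment _ hB hpB (hseg _ _ _ ?_ ?_)⟩
      · exact le_trans hpq (htb r (hε.trans hr))
      · linarith [hlow r hr A hA p hpA]
    exact ⟨B, hB, fun p hp hpA => hthick₁ r hr A hA B hB p.1 hpA (hAB hpA).2 p.2 (hRdist p hp)⟩
  have hup : ∀ r (_ : ε < r), ∀ B ∈ ((densityContour f).at' r (hε.trans ‹_›)).clusters, ∀ y ∈ B,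
      ∀ p : X, dist y p.1 ≤ ρ → ε / 2 ≤ r - ε / 2 ∧ r - ε / 2 ≤ M + 1 ∧ p ∈ U (r - ε / 2) := by
    intro r hr B hB y hy p hp
    have h1 := densityContour_subset hB hy
    have h2 := hM y
    -- Passing from `y` to `p` costs `ε/4` in `f`, and the filtration estimate costs another `ε/4`;
    -- hence the scale `r - ε/2`.
    refine ⟨by linarith, by linarith, (hU _ (by linarith) (by linarith) p).2 ?_⟩
    linarith [(abs_le.1 (hmod y p.1 (le_trans hp hρb))).2]
  have hUmem : ∀ r (_ : ε < r), ∀ B ∈ ((densityContour f).at' r (hε.trans ‹_›)).clusters, ∀ y ∈ B,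
      ∀ p : X, dist y p.1 ≤ ρ → p ∈ U (r - ε) := by
    intro r hr B hB y hy p hp
    obtain ⟨h1, h2, h3⟩ := hup r hr B hB y hy p hp
    obtain ⟨A, hA, hpA⟩ := Clustering.exists_mem_linkage (t := ⟨_, ht (r - ε / 2) (by linarith)⟩) h3
    rw [← hH _ (by linarith)] at hA
    -- The scale `r - ε` may fall below `ε/2`, where `hU` says nothing, so membership is inherited
    -- from `r - ε/2`.
    obtain ⟨A', hA', hAA'⟩ := H.monotone
        (show OrderDual.toDual (⟨r - ε / 2, by linarith⟩ : PosReal) ≤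
          OrderDual.toDual ⟨r - ε, sub_pos.2 hr⟩ from
            show r - ε ≤ r - ε / 2 by linarith) A hA
    have hA' : A' ∈ (H.at' (r - ε) (sub_pos.2 hr)).clusters := hA'
    rw [hH] at hA'
    exact Clustering.linkage_subset hA' (hAA' hpA)
  have hstep : ∀ r (hr : ε < r), ∀ B ∈ ((densityContour f).at' r (hε.trans hr)).clusters,
      ∀ A ∈ (H.at' (r - ε) (sub_pos.2 hr)).clusters, ∀ y ∈ B, ∀ y' ∈ B, dist y y' ≤ ρ →
      ∀ p q : X, dist y p.1 ≤ ρ → dist y' q.1 ≤ ρ → p ∈ A → q ∈ A := by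
    intro r hr B hB A hA y hy y' hy' hyy' p q hp hq hpA
    rw [hH] at hA
    refine Clustering.mem_linkage_of_dist_le hA hpA (hUmem r hr B hB y' hy' q hq) ?_
    have h1 := densityContour_subset hB hy
    have h2 := htanti (r - ε) (M + 1) (sub_pos.2 hr) (by linarith [hM y])
    -- Three hops of length `ρ`: the source of `3 * ρ ≤ t (M + 1)`.
    have h3 : dist p.1 q.1 ≤ dist y p.1 + dist y y' + dist y' q.1 := by
      rw [dist_comm y p.1]
      exact dist_triangle4 _ _ _ _
    change dist p.1 q.1 ≤ t (r - ε)
    linarith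
  have hinter₂ : ∀ r (hr : ε < r), ∀ B ∈ ((densityContour f).at' r (hε.trans hr)).clusters,
      ∃ A ∈ (H.at' (r - ε) (sub_pos.2 hr)).clusters, Transports (Prod.swap ⁻¹' R) B A := by
    intro r hr B hB
    obtain ⟨y₀, hy₀⟩ := ((densityContour f).at' r (hε.trans hr)).nonempty B hB
    obtain ⟨p₀, hp₀⟩ := hdense y₀
    obtain ⟨A, hA, hpA⟩ := Clustering.exists_mem_linkage (t := ⟨_, ht (r - ε) (sub_pos.2 hr)⟩)
      (hUmem r hr B hB y₀ hy₀ p₀ hp₀)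
    rw [← hH _ (sub_pos.2 hr)] at hA
    refine ⟨A, hA, ?_⟩
    -- Being `ρ`-close to a point of `A` is a locally constant property on `B`, hence constant by
    -- connectedness.
    have key : ∀ y ∈ B, ∀ y' ∈ B,
        ((∃ p ∈ A, dist y p.1 ≤ ρ) ↔ (∃ p ∈ A, dist y' p.1 ≤ ρ)) := by
      intro y hy y' hy'
      have hone : ∀ y ∈ B, ∀ y' ∈ B, dist y y' ≤ ρ → (∃ p ∈ A, dist y p.1 ≤ ρ) →
          ∃ p ∈ A, dist y' p.1 ≤ ρ := by
        rintro y hy y' hy' hyy' ⟨p, hpA, hp⟩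
        obtain ⟨q, hq⟩ := hdense y'
        exact ⟨q, hstep r hr B hB A hA y hy y' hy' hyy' p q hp hq hpA, hq⟩
      refine (densityContour_isPreconnected hB).induction₂
        (fun y y' => (∃ p ∈ A, dist y p.1 ≤ ρ) ↔ (∃ p ∈ A, dist y' p.1 ≤ ρ)) ?_ ?_ ?_ hy hy'
      · intro z hz
        filter_upwards [self_mem_nhdsWithin, mem_nhdsWithin_of_mem_nhds (Metric.ball_mem_nhds z hρ)]
          with w hw hzw
        have hzw : dist w z < ρ := hzw
        exact ⟨hone z hz w hw (by rw [dist_comm]; exact hzw.le), hone w hw z hz hzw.le⟩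
      · exact fun _ _ _ _ _ _ h1 h2 => h1.trans h2
      · exact fun _ _ _ _ h => h.symm
    rintro ⟨y, q⟩ hq hy
    obtain ⟨p, hpA, hp⟩ := (key y₀ hy₀ y hy).1 ⟨p₀, hpA, hp₀⟩
    exact hstep r hr B hB A hA y hy y hy (by simpa using hρ.le) p q hp (hRdist (q, y) hq) hpA
  refine ⟨fun r hr A _ => A.toFinite.measurableSet, densityContour_isMeasurable hcont,
    ⟨hcorr, fun r hr hrε => ⟨?_, ?_⟩⟩, fun r hr hrε N => ⟨?_, ?_⟩⟩
  · rintro _ ⟨⟨z, hz⟩, A, hA, rfl⟩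
    obtain ⟨B, hB, hAB⟩ := hinter₁ r (sub_pos.1 hrε) A hA
    refine ⟨_, ⟨⟨z, ?_⟩, B, hB, rfl⟩, ?_⟩
    · exact hAB z.1 z.2 hz
    · exact fun w hw => hAB w.1 w.2 hw
  · rintro _ ⟨⟨z, hz⟩, B, hB, rfl⟩
    obtain ⟨A, hA, hBA⟩ := hinter₂ r (sub_pos.1 hrε) B hB
    have hBA' : ∀ w : R, w.1.2 ∈ B → w.1.1 ∈ A := fun w hw => hBA (w.1.2, w.1.1) w.2 hw
    refine ⟨_, ⟨⟨z, ?_⟩, A, hA, rfl⟩, ?_⟩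
    · exact hBA' z hz
    · exact hBA'
  · intro A B hA hB hAB
    -- The `ρ`-thickening of the union of the `A i` already lies in the union of the transported
    -- clusters.
    refine (hprok₁ _).trans (add_le_add_left (measure_mono ?_) _)
    rintro y ⟨a, ha, hya⟩
    obtain ⟨i, hi⟩ := mem_iUnion.1 ha
    exact mem_iUnion.2 ⟨i, hthick₁ r (sub_pos.1 hrε) _ (hA i) _ (hB i) a hi
      (hAB i (a, a.1) (hRdiag a) hi) y hya⟩
  · intro B A hB hA hBA
    refine (hprok₂ _).trans (add_le_add_left (measure_mono ?_) _)
    rintro q ⟨y, hy, hyq⟩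
    obtain ⟨i, hi⟩ := mem_iUnion.1 hy
    obtain ⟨p, hp⟩ := hcorr.2 y
    have hpA : p ∈ A i := hBA i (y, p) hp hi
    exact mem_iUnion.2 ⟨i, hstep r (sub_pos.1 hrε) (B i) (hB i) (A i) (hA i) y hi y hi
      (by simpa using hρ.le) p q (hRdist (p, y) hp) hyq hpA⟩

end Interleaving

/-! ### Laws of large numbers and absence of ties -/

section Empirical

open ProbabilityTheory

variable {X : Type*} [MeasurableSpace X] {μ : Measure X} [IsProbabilityMeasure μ]

/-- Chebyshev's inequality for empirical means of a bounded function. -/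
theorem pi_abs_mean_sub_integral_le {g : X → ℝ} (hg : Measurable g) (h0 : ∀ x, 0 ≤ g x)
    (h1 : ∀ x, g x ≤ 1) {η : ℝ} (hη : 0 < η) {n : ℕ} (hn : 0 < n) :
    (Measure.pi fun _ : Fin n => μ) {x | η ≤ |(∑ i, g (x i)) / n - ∫ y, g y ∂μ|} ≤
      ENNReal.ofReal (1 / (n * η ^ 2)) := by
  have hn' : (0 : ℝ) < n := by exact_mod_cast hn
  have hg2 : MemLp g 2 μ := MemLp.of_bound hg.aestronglyMeasurable 1
    (ae_of_all _ fun x => by rw [Real.norm_of_nonneg (h0 x)]; exact h1 x)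
  have hmem : ∀ i : Fin n, MemLp (fun x : Fin n → X => g (x i)) 2 (Measure.pi fun _ => μ) :=
    fun i => hg2.comp_measurePreserving (measurePreserving_eval (fun _ => μ) i)
  have hvar : variance g μ ≤ 1 := by
    refine (variance_le_expectation_sq hg.aestronglyMeasurable).trans ?_
    calc ∫ x, (g ^ 2) x ∂μ ≤ ∫ _, (1 : ℝ) ∂μ := by
          refine integral_mono hg2.integrable_sq (integrable_const _) fun x => ?_
          exact pow_le_one₀ (h0 x) (h1 x)
      _ = 1 := by simp
  have hsum := variance_sum_pi (μ := fun _ : Fin n => μ) (X := fun _ => g) fun _ => hg2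
  simp only [Finset.sum_const, Finset.card_univ, Fintype.card_fin, nsmul_eq_mul] at hsum
  have hint : ∫ x, (∑ i, fun x : Fin n → X => g (x i)) x ∂(Measure.pi fun _ : Fin n => μ) =
      n * ∫ y, g y ∂μ := by
    simp only [Finset.sum_apply]
    rw [integral_finsetSum _ fun i _ => (hmem i).integrable (by norm_num)]
    have : ∀ i : Fin n, ∫ x : Fin n → X, g (x i) ∂(Measure.pi fun _ : Fin n => μ) =
        ∫ y, g y ∂μ := fun i => by
      conv_rhs => rw [← (measurePreserving_eval (fun _ : Fin n => μ) i).map_eq]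
      rw [integral_map (measurable_pi_apply i).aemeasurable hg.aestronglyMeasurable]
    simp [this]
  have hcheb := meas_ge_le_variance_div_sq (memLp_finsetSum' Finset.univ fun i _ => hmem i)
    (mul_pos hn' hη)
  rw [hint, hsum] at hcheb
  refine le_trans (measure_mono ?_) (hcheb.trans (ENNReal.ofReal_le_ofReal ?_))
  · intro x hx
    simp only [mem_ofPred_eq, Finset.sum_apply] at hx ⊢
    have : ∑ i, g (x i) - n * ∫ y, g y ∂μ = n * ((∑ i, g (x i)) / n - ∫ y, g y ∂μ) := by
      field_simp
    rw [this, abs_mul, abs_of_pos hn']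
    exact mul_le_mul_of_nonneg_left hx hn'.le
  · rw [div_le_div_iff₀ (by positivity) (by positivity)]
    have : 0 < (n : ℝ) * η ^ 2 := by positivity
    nlinarith [mul_le_mul_of_nonneg_right hvar (show 0 ≤ (n : ℝ) * (n * η ^ 2) by positivity)]

/-- Uniform weak law of large numbers for the functions that factor through a given simple
function. -/
theorem tendsto_pi_not_uniform_mean (q : SimpleFunc X X) {κ : ℝ} (hκ : 0 < κ) :
    Tendsto (fun n : ℕ => (Measure.pi fun _ : Fin n => μ)
      {x | ¬ ∀ g : X → ℝ, (∀ c, 0 ≤ g c) → (∀ c, g c ≤ 1) →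
        |(∑ i, g (q (x i))) / n - ∫ y, g (q y) ∂μ| ≤ κ}) atTop (𝓝 0) := by
  classical
  -- The `+ 1` only keeps the divisor positive.
  set m : ℝ := q.range.card + 1
  have hm : 0 < m := by positivity
  set η := κ / m
  have hη : 0 < η := div_pos hκ hm
  set ind : X → X → ℝ := fun c y => if q y = c then 1 else 0 with hind
  have hmeas : ∀ c, Measurable (ind c) := fun c =>
    Measurable.ite (q.measurableSet_fiber c) measurable_const measurable_const
  have hind0 : ∀ c x, 0 ≤ ind c x := fun c x => by simp only [hind]; split_ifs <;> norm_num
  have hind1 : ∀ c x, ind c x ≤ 1 := fun c x => by simp only [hind]; split_ifs <;> norm_num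
  have hbound : ∀ n : ℕ, 0 < n → (Measure.pi fun _ : Fin n => μ)
      {x | ¬ ∀ g : X → ℝ, (∀ c, 0 ≤ g c) → (∀ c, g c ≤ 1) →
        |(∑ i, g (q (x i))) / n - ∫ y, g (q y) ∂μ| ≤ κ} ≤
      ∑ _c ∈ q.range, ENNReal.ofReal (1 / (n * η ^ 2)) := by
    intro n hn
    refine le_trans (measure_mono ?_) ((measure_biUnion_finset_le q.range fun c =>
      {x : Fin n → X | η ≤ |(∑ i, ind c (x i)) / n - ∫ y, ind c y ∂μ|}).trans
      (Finset.sum_le_sum fun c _ => pi_abs_mean_sub_integral_le (hmeas c) (hind0 c) (hind1 c)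
        hη hn))
    intro x hx
    by_contra hcon
    refine hx fun g h0 h1 => ?_
    simp only [mem_iUnion, mem_ofPred_eq, not_exists, not_le] at hcon
    -- Every test function is a combination of the same finitely many cell indicators with
    -- coefficients in `[0, 1]`; this gives uniformity in `g`.
    have hg : ∀ y, g (q y) = ∑ c ∈ q.range, g c * ind c y := fun y => by
      simp [hind]
    have hint : ∫ y, g (q y) ∂μ = ∑ c ∈ q.range, g c * ∫ y, ind c y ∂μ := by
      simp_rw [hg]
      rw [integral_finsetSum]
      · simp_rw [integral_const_mul]
      · intro c _
        refine Integrable.const_mul (Integrable.of_bound (hmeas c).aestronglyMeasurable 1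
          (ae_of_all _ fun x => ?_)) _
        rw [Real.norm_of_nonneg (hind0 c x)]
        exact hind1 c x
    have hsum : (∑ i, g (q (x i))) / n = ∑ c ∈ q.range, g c * ((∑ i, ind c (x i)) / n) := by
      simp_rw [hg]
      rw [Finset.sum_comm, Finset.sum_div]
      refine Finset.sum_congr rfl fun c _ => ?_
      rw [← Finset.mul_sum, mul_div_assoc]
    rw [hint, hsum, ← Finset.sum_sub_distrib]
    calc |∑ c ∈ q.range, (g c * ((∑ i, ind c (x i)) / n) - g c * ∫ y, ind c y ∂μ)|
        ≤ ∑ c ∈ q.range, |g c * ((∑ i, ind c (x i)) / n) - g c * ∫ y, ind c y ∂μ| :=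
          Finset.abs_sum_le_sum_abs _ _
      _ ≤ ∑ _c ∈ q.range, η := by
          refine Finset.sum_le_sum fun c hc => ?_
          rw [← mul_sub, abs_mul, abs_of_nonneg (h0 c)]
          exact (mul_le_of_le_one_left (abs_nonneg _) (h1 c)).trans (hcon c hc).le
      _ = q.range.card * η := by simp
      _ ≤ m * η := by gcongr; simp [m]
      _ = κ := by simp only [η]; field_simp
  have hlim : Tendsto (fun n : ℕ => ∑ _c ∈ q.range, ENNReal.ofReal (1 / (n * η ^ 2))) atTop
      (𝓝 (∑ _c ∈ q.range, 0)) := by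
    refine tendsto_finsetSum _ fun c _ => ?_
    rw [← ENNReal.ofReal_zero]
    refine ENNReal.tendsto_ofReal ?_
    exact tendsto_const_nhds.div_atTop
      (tendsto_natCast_atTop_atTop.atTop_mul_const (by positivity))
  simp only [Finset.sum_const_zero] at hlim
  refine tendsto_of_tendsto_of_tendsto_of_le_of_le' tendsto_const_nhds hlim
    (Eventually.of_forall fun _ => zero_le) ?_
  filter_upwards [eventually_gt_atTop 0] with n hn using hbound n hn

/-- Two coordinates are independent, and by Fubini the diagonal is null for the square of an
atomless measure. -/
theorem pi_not_injective_eq_zero [MeasurableEq X] [MeasurableSingletonClass X]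
    [NullSingletonClass μ]
    (n : ℕ) : (Measure.pi fun _ : Fin n => μ) {x | ¬ Function.Injective x} = 0 := by
  have hsub : {x : Fin n → X | ¬ Function.Injective x} ⊆
      ⋃ i, ⋃ j, ⋃ (_ : i ≠ j), {x | x i = x j} := by
    intro x hx
    simp only [Function.Injective, mem_ofPred_eq, not_forall] at hx
    obtain ⟨i, j, hij, hne⟩ := hx
    simp only [mem_iUnion]
    exact ⟨i, j, hne, hij⟩
  refine measure_mono_null hsub ?_
  simp only [measure_iUnion_null_iff]
  intro i j hij
  have hind : IndepFun (fun x : Fin n → X => x i) (fun x => x j) (Measure.pi fun _ => μ) :=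
    (iIndepFun_pi (μ := fun _ : Fin n => μ) (X := fun _ => id) fun _ => aemeasurable_id).indepFun
      hij
  have hmap := (indepFun_iff_map_prod_eq_prod_map_map (measurable_pi_apply i).aemeasurable
    (measurable_pi_apply j).aemeasurable).1 hind
  have h1 : ∀ i : Fin n, (Measure.pi fun _ : Fin n => μ).map (fun x => x i) = μ := fun i =>
    (measurePreserving_eval (fun _ : Fin n => μ) i).map_eq
  rw [h1, h1] at hmap
  have hdiag : MeasurableSet {p : X × X | p.1 = p.2} := measurableSet_diagonal
  have h2 : (μ.prod μ) {p : X × X | p.1 = p.2} = 0 := by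
    rw [Measure.measure_prod_null hdiag]
    refine ae_of_all _ fun x => ?_
    have : Prod.mk x ⁻¹' {p : X × X | p.1 = p.2} = {x} := by ext y; simp [eq_comm]
    change μ (Prod.mk x ⁻¹' {p : X × X | p.1 = p.2}) = 0
    rw [this, measure_singleton]
  rw [← hmap, Measure.map_apply (by fun_prop) hdiag] at h2
  exact h2

end Empirical

/-- Diagonal choice of parameters. -/
theorem exists_seq_tendsto_atTop_eventually {Q : ℕ → ℕ → Prop} (h : ∀ k, ∀ᶠ n in atTop, Q k n) :
    ∃ κ : ℕ → ℕ, Tendsto κ atTop atTop ∧ ∀ᶠ n in atTop, Q (κ n) n := by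
  classical
  set P : ℕ → ℕ → Prop := fun n k => ∀ n' ≥ n, Q k n'
  -- The largest `k ≤ n` whose property already holds from `n` onwards.
  refine ⟨fun n => Nat.findGreatest (P n) n, ?_, ?_⟩
  · refine tendsto_atTop.2 fun k => ?_
    obtain ⟨N, hN⟩ := eventually_atTop.1 (h k)
    filter_upwards [eventually_ge_atTop (max k N)] with n hn
    exact Nat.le_findGreatest ((le_max_left _ _).trans hn)
      fun n' hn' => hN n' (((le_max_right _ _).trans hn).trans hn')
  -- `Nat.findGreatest` defaults to `0` if nothing qualifies, so `n` must be large enough for `0`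
  -- itself to qualify.
  · obtain ⟨N, hN⟩ := eventually_atTop.1 (h 0)
    filter_upwards [eventually_ge_atTop N] with n hn
    have : P n (Nat.findGreatest (P n) n) :=
      Nat.findGreatest_spec (m := 0) (Nat.zero_le n) fun n' hn' => hN n' (hn.trans hn')
    exact this n le_rfl

/-! ### The measure with density `f` -/

section DensityMeasure

variable {d : ℕ} {f : E d → ℝ}

theorem measurableEmbedding_tsupport_val :
    MeasurableEmbedding (Subtype.val : tsupport f → E d) :=
  MeasurableEmbedding.subtype_coe (isClosed_tsupport f).measurableSet

theorem map_val_densityMeasure :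
    (densityMeasure f).map Subtype.val = volume.withDensity fun x => ENNReal.ofReal (f x) := by
  rw [densityMeasure, measurableEmbedding_tsupport_val.map_comap, Subtype.range_coe]
  refine Measure.restrict_eq_self_of_ae_mem ?_
  have hz : (volume.withDensity fun x => ENNReal.ofReal (f x)) (tsupport f)ᶜ = 0 := by
    rw [withDensity_apply _ (isClosed_tsupport f).measurableSet.compl]
    refine setLIntegral_eq_zero (isClosed_tsupport f).measurableSet.compl fun x hx => ?_
    simp [image_eq_zero_of_notMem_tsupport hx]
  exact hz

theorem isProbabilityMeasure_densityMeasure (hf : IsProbabilityDensity f) :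
    IsProbabilityMeasure (densityMeasure f) := by
  constructor
  have h := congrArg (fun m => m univ) (map_val_densityMeasure (f := f))
  simp only [Measure.map_apply measurable_subtype_coe MeasurableSet.univ, preimage_univ,
    withDensity_apply _ MeasurableSet.univ, Measure.restrict_univ] at h
  rw [h, ← ofReal_integral_eq_lintegral_ofReal hf.integrable (ae_of_all _ hf.nonneg),
    hf.integral_eq_one, ENNReal.ofReal_one]

theorem densityMeasure_preimage {A : Set (E d)} (hA : MeasurableSet A) :
    densityMeasure f (Subtype.val ⁻¹' A) = ∫⁻ x in A, ENNReal.ofReal (f x) := by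
  rw [← Measure.map_apply measurable_subtype_coe hA, map_val_densityMeasure,
    withDensity_apply _ hA]

theorem nullSingletonClass_densityMeasure (hd : 0 < d) :
    NullSingletonClass (densityMeasure f) := by
  constructor
  intro y
  have : Nonempty (Fin d) := ⟨⟨0, hd⟩⟩
  have h : ({y} : Set (tsupport f)) = Subtype.val ⁻¹' {(y : E d)} := by
    ext z; simp [Subtype.ext_iff]
  rw [h, densityMeasure_preimage (measurableSet_singleton _)]
  simp

theorem integral_densityMeasure (hf : IsProbabilityDensity f) (hcont : Continuous f) (g : E d → ℝ)
    (hg : Measurable g) :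
    ∫ y, g y ∂(densityMeasure f) = ∫ x, f x * g x := by
  have hmeas : Measurable fun x => ENNReal.ofReal (f x) :=
    ENNReal.measurable_ofReal.comp hcont.measurable
  rw [← integral_map (f := g) measurable_subtype_coe.aemeasurable hg.aestronglyMeasurable,
    map_val_densityMeasure, integral_withDensity_eq_integral_toReal_smul hmeas
      (ae_of_all _ fun x => ENNReal.ofReal_lt_top)]
  refine integral_congr_ae (ae_of_all _ fun x => ?_)
  simp [ENNReal.toReal_ofReal (hf.nonneg x)]

/-- A ball about a point of the support meets the open set where `f > 0`, in a nonempty open set of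
positive volume. -/
theorem densityMeasure_ball_pos (hf : IsProbabilityDensity f) (hcont : Continuous f)
    (y : tsupport f) {ρ : ℝ} (hρ : 0 < ρ) : 0 < densityMeasure f (Metric.ball y ρ) := by
  have hmeas : Measurable fun x => ENNReal.ofReal (f x) :=
    ENNReal.measurable_ofReal.comp hcont.measurable
  have h : Metric.ball y ρ = Subtype.val ⁻¹' Metric.ball (y : E d) ρ := rfl
  rw [h, densityMeasure_preimage Metric.isOpen_ball.measurableSet,
    ← withDensity_apply _ Metric.isOpen_ball.measurableSet, pos_iff_ne_zero, Ne,
    withDensity_apply_eq_zero hmeas]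
  obtain ⟨z, hz, hzf⟩ := mem_closure_iff.1 y.2 _ Metric.isOpen_ball (Metric.mem_ball_self hρ)
  have hopen : IsOpen ({x | ENNReal.ofReal (f x) ≠ 0} ∩ Metric.ball (y : E d) ρ) := by
    refine IsOpen.inter ?_ Metric.isOpen_ball
    exact isOpen_ne_fun (ENNReal.continuous_ofReal.comp hcont) continuous_const
  refine (hopen.measure_pos _ ⟨z, ?_, hz⟩).ne'
  have : 0 < f z := lt_of_le_of_ne (hf.nonneg z) (Ne.symm hzf)
  simpa using this

theorem densityMeasure_real_closedBall_le {M : ℝ} (hM0 : 0 ≤ M)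
    (hM : ∀ x, f x ≤ M) (p : tsupport f) {a : ℝ} (ha : 0 ≤ a) :
    (densityMeasure f).real (Metric.closedBall p a) ≤
      M * (a ^ d * volume.real (Metric.ball (0 : E d) 1)) := by
  have h : Metric.closedBall p a = Subtype.val ⁻¹' Metric.closedBall (p : E d) a := rfl
  rw [Measure.real, h, densityMeasure_preimage Metric.isClosed_closedBall.measurableSet]
  have h1 : ∫⁻ x in Metric.closedBall (p : E d) a, ENNReal.ofReal (f x) ≤
      ENNReal.ofReal M * volume (Metric.closedBall (p : E d) a) := by
    rw [← setLIntegral_const]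
    exact lintegral_mono fun x => ENNReal.ofReal_le_ofReal (hM x)
  have h2 : (volume (Metric.closedBall (p : E d) a)).toReal =
      a ^ d * volume.real (Metric.ball (0 : E d) 1) := by
    rw [Measure.addHaar_closedBall _ _ ha]
    simp [Measure.real, ha]
  refine (ENNReal.toReal_mono (ENNReal.mul_ne_top ENNReal.ofReal_ne_top
    measure_closedBall_lt_top.ne) h1).trans ?_
  rw [ENNReal.toReal_mul, ENNReal.toReal_ofReal hM0, h2]

end DensityMeasure

/-! ### Bias of kernel smoothing -/

section KernelEstimate

variable {d : ℕ} {f : E d → ℝ} {K : DensityKernel}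

theorem exists_kernel_tail_le (hK : K.FiniteVolume d) {δ : ℝ} (hδ : 0 < δ) :
    ∃ W : ℝ, 0 < W ∧ ∫ w in {w : E d | W < ‖w‖}, K ‖w‖ ≤ δ := by
  have hanti : Antitone fun n : ℕ => {w : E d | (n : ℝ) < ‖w‖} := fun m n hmn w (hw : (n : ℝ) < ‖w‖) =>
    show (m : ℝ) < ‖w‖ from lt_of_le_of_lt (Nat.cast_le.2 hmn) hw
  have hmeas : ∀ n : ℕ, MeasurableSet {w : E d | (n : ℝ) < ‖w‖} := fun n =>
    measurableSet_lt measurable_const measurable_norm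
  have h := tendsto_setIntegral_of_antitone (μ := volume) (f := fun w : E d => K ‖w‖) hmeas hanti
    ⟨0, hK.integrableOn⟩
  have hempty : ⋂ n : ℕ, {w : E d | (n : ℝ) < ‖w‖} = ∅ := by
    refine eq_empty_of_forall_notMem fun w hw => ?_
    obtain ⟨n, hn⟩ := exists_nat_ge ‖w‖
    exact absurd (mem_iInter.1 hw n) (not_lt.2 hn)
  rw [hempty, setIntegral_empty] at h
  obtain ⟨n, hn1, hn2⟩ := ((h.eventually (gt_mem_nhds hδ)).and (eventually_gt_atTop 0)).exists
  exact ⟨n, by exact_mod_cast hn2, hn1.le⟩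

theorem integrable_kernel_div (hK : K.FiniteVolume d) {s : ℝ} (hs : 0 < s) :
    Integrable fun z : E d => K (‖z‖ / s) := by
  have h := (integrable_comp_smul_iff volume (fun w : E d => K ‖w‖) (inv_ne_zero hs.ne')).2 hK
  refine h.congr (ae_of_all _ fun z => ?_)
  simp only [norm_smul, norm_inv, Real.norm_of_nonneg hs.le]
  rw [div_eq_inv_mul]

/-- Smoothing a bounded uniformly continuous function by a kernel of small bandwidth changes it
uniformly little. -/
theorem exists_abs_kernel_smoothing_sub_le (hK : K.FiniteVolume d) (hcont : Continuous f)
    (huc : UniformContinuous f) {M : ℝ} (h0 : ∀ x, 0 ≤ f x) (hM : ∀ x, f x ≤ M) {δ : ℝ}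
    (hδ : 0 < δ) :
    ∃ b : ℝ, 0 < b ∧ ∀ s, 0 < s → s ≤ b → ∀ p : E d,
      |(∫ y, f y * K (dist p y / s)) - kernelVolume d K s * f p| ≤ δ * kernelVolume d K s := by
  have hv := kernelVolume_one_pos hK
  have hM0 : 0 ≤ M := (h0 0).trans (hM 0)
  obtain ⟨W, hW, htail⟩ := exists_kernel_tail_le hK
    (δ := δ * kernelVolume d K 1 / 2 / (M + 1)) (by positivity)
  obtain ⟨a, ha, hfa⟩ := Metric.uniformContinuous_iff.1 huc (δ / 2) (by positivity)
  -- The kernel's bulk `‖z‖ ≤ s * W` then lies strictly within the radius `a` where `f` varies by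
  -- less than `δ / 2`.
  refine ⟨a / W / 2, by positivity, fun s hs hsb p => ?_⟩
  have hsW : s * W < a := by
    have h1 : s < a / W := lt_of_le_of_lt hsb (half_lt_self (by positivity))
    rwa [lt_div_iff₀ hW] at h1
  -- In the rescaled variable `w = z / s` this dominates the error independently of `s` and `p`:
  -- oscillation of `f` in the bulk, the crude bound `M` on the tail.
  set G : E d → ℝ := fun w => K ‖w‖ * (δ / 2) + M * {w : E d | W < ‖w‖}.indicator (fun w => K ‖w‖) w
    with hG
  have hmeasW : MeasurableSet {w : E d | W < ‖w‖} :=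
    measurableSet_lt measurable_const measurable_norm
  have hGint : Integrable G := (hK.mul_const _).add ((hK.indicator hmeasW).const_mul _)
  have hGle : ∫ w, G w ≤ δ * kernelVolume d K 1 := by
    rw [hG, integral_add (hK.mul_const _) ((hK.indicator hmeasW).const_mul _), integral_mul_const,
      integral_const_mul, integral_indicator hmeasW]
    have h1 : ∫ w : E d, K ‖w‖ = kernelVolume d K 1 := by simp [kernelVolume]
    rw [h1]
    have h2 : M * ∫ w in {w : E d | W < ‖w‖}, K ‖w‖ ≤ (M + 1) *
        (δ * kernelVolume d K 1 / 2 / (M + 1)) :=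
      mul_le_mul (by linarith) htail
        (setIntegral_nonneg hmeasW fun w _ => K.nonneg _ (norm_nonneg w)) (by linarith)
    have h3 : (M + 1) * (δ * kernelVolume d K 1 / 2 / (M + 1)) = δ * kernelVolume d K 1 / 2 := by
      field_simp
    linarith
  have hGs : ∫ z : E d, G (s⁻¹ • z) = s ^ d * ∫ w, G w := by
    have h := Measure.integral_comp_inv_smul_of_nonneg (volume : Measure (E d)) G hs.le
    simpa only [finrank_euclideanSpace, Fintype.card_fin, smul_eq_mul] using h
  have htrans : ∫ y, f y * K (dist p y / s) = ∫ z, f (p + z) * K (‖z‖ / s) := by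
    rw [← integral_add_left_eq_self (fun y => f y * K (dist p y / s)) p]
    simp
  have hKs := integrable_kernel_div hK hs
  have hfK : Integrable fun z : E d => f (p + z) * K (‖z‖ / s) := by
    refine hKs.bdd_mul (c := M) (hcont.comp (continuous_const.add continuous_id)).aestronglyMeasurable
      (ae_of_all _ fun z => ?_)
    rw [Real.norm_of_nonneg (h0 _)]
    exact hM _
  have hvol : kernelVolume d K s * f p = ∫ z : E d, f p * K (‖z‖ / s) := by
    rw [integral_const_mul, kernelVolume, mul_comm]
  rw [htrans, hvol, ← integral_sub hfK (hKs.const_mul _), kernelVolume_eq d K hs]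
  calc |∫ z : E d, (f (p + z) * K (‖z‖ / s) - f p * K (‖z‖ / s))|
      ≤ ∫ z : E d, |f (p + z) * K (‖z‖ / s) - f p * K (‖z‖ / s)| := abs_integral_le_integral_abs
    _ ≤ ∫ z : E d, G (s⁻¹ • z) := by
        refine integral_mono (hfK.sub (hKs.const_mul _)).abs
          ((integrable_comp_smul_iff volume G (inv_ne_zero hs.ne')).2 hGint) fun z => ?_
        have hnorm : ‖s⁻¹ • z‖ = ‖z‖ / s := by
          rw [norm_smul, norm_inv, Real.norm_of_nonneg hs.le, div_eq_inv_mul]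
        have hK0 : 0 ≤ K (‖z‖ / s) := K.nonneg _ (by positivity)
        simp only [hG, indicator, mem_ofPred_eq, hnorm]
        rw [← sub_mul, abs_mul, abs_of_nonneg hK0]
        split_ifs with hz
        · have : |f (p + z) - f p| ≤ M := by
            rw [abs_le]
            constructor <;> linarith [h0 (p + z), h0 p, hM (p + z), hM p]
          nlinarith [mul_le_mul_of_nonneg_right this hK0, mul_nonneg hK0 hδ.le]
        · have hza : dist (p + z) p < a := by
            rw [not_lt, div_le_iff₀ hs] at hz
            simp only [dist_self_add_left]
            linarith [mul_comm s W]
          have := (hfa hza).le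
          rw [Real.dist_eq] at this
          nlinarith [mul_le_mul_of_nonneg_right this hK0]
    _ ≤ δ * (s ^ d * kernelVolume d K 1) := by
        rw [hGs]
        have := mul_le_mul_of_nonneg_left hGle (pow_nonneg hs.le d)
        linarith

end KernelEstimate

/-! ### Kernel means on the good event -/

section Discretization

variable {X : Type*} [MetricSpace X] [MeasurableSpace X] [BorelSpace X] {μ : Measure X}
  [IsProbabilityMeasure μ] {K : DensityKernel}

/-- Project to the nearest point of a finite `ρ`-net. -/
theorem exists_simpleFunc_dist_le [CompactSpace X] [Nonempty X] {ρ : ℝ} (hρ : 0 < ρ) :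
    ∃ q : SimpleFunc X X, ∀ y, dist (q y) y ≤ ρ := by
  obtain ⟨T, hT, hTcov⟩ := Metric.totallyBounded_iff.1 (isCompact_univ (X := X)).totallyBounded ρ hρ
  obtain ⟨x₀⟩ := ‹Nonempty X›
  obtain ⟨y₀, hy₀, -⟩ := mem_iUnion₂.1 (hTcov (mem_univ x₀))
  obtain ⟨n, e, he⟩ := hT.fin_embedding
  set e' : ℕ → X := fun i => if h : i < n then e ⟨i, h⟩ else y₀
  refine ⟨SimpleFunc.nearestPt e' n, fun y => ?_⟩
  obtain ⟨z, hz, hyz⟩ := mem_iUnion₂.1 (hTcov (mem_univ y))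
  rw [← he] at hz
  obtain ⟨i, rfl⟩ := hz
  have h := SimpleFunc.edist_nearestPt_le e' y (k := i) i.2.le
  have hi : e' i = e i := by simp [e']
  rw [hi, edist_dist, edist_dist, ENNReal.ofReal_le_ofReal_iff dist_nonneg] at h
  refine h.trans ?_
  rw [dist_comm]
  exact (show dist y (e i) < ρ from hyz).le

variable {q : SimpleFunc X X} {ρ κ s lam a : ℝ} {n : ℕ} {x : Fin n → X}

/-- `K` may jump, so replacing points by cell centres cannot be controlled by a modulus of
continuity. Outside the ball of radius `a`, a shift of the distance by `2 * ρ` is absorbed by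
dilating the bandwidth by `lam`, using monotonicity of `K`; inside it, `K ≤ K 0` is enough. -/
theorem mean_kernel_le (hq : ∀ y, dist (q y) y ≤ ρ)
    (hx : ∀ g : X → ℝ, (∀ c, 0 ≤ g c) → (∀ c, g c ≤ 1) →
      |(∑ i, g (q (x i))) / n - ∫ y, g (q y) ∂μ| ≤ κ)
    (hs : 0 < s) (hlam : 1 < lam) (ha : 2 * ρ * lam ≤ a * (lam - 1)) (p : X) :
    (∑ i, K (dist p (x i) / s)) / n ≤ ∫ y, K (dist p y / (lam * s)) ∂μ +
      K 0 * (μ.real (Metric.closedBall p a) + κ) := by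
  have hK0 := K.zero_pos
  have hanti : ∀ u v : ℝ, 0 ≤ u → u ≤ v → K v ≤ K u := fun u v hu huv =>
    K.antitoneOn hu (hu.trans huv) huv
  -- Division by `K 0` puts `g` in `[0, 1]`; the `max` keeps the argument where `K` is controlled.
  set g : X → ℝ := fun c => K (max (dist p c - ρ) 0 / s) / K 0 with hg
  have hgK : ∀ c, K 0 * g c = K (max (dist p c - ρ) 0 / s) := fun c => by
    simp only [hg]; field_simp
  have hg0 : ∀ c, 0 ≤ g c := fun c => div_nonneg (K.nonneg _ (by positivity)) hK0.le
  have hg1 : ∀ c, g c ≤ 1 := fun c =>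
    (div_le_one hK0).2 (hanti _ _ le_rfl (by positivity))
  have h1 : (∑ i, K (dist p (x i) / s)) / n ≤ K 0 * ((∑ i, g (q (x i))) / n) := by
    rw [← mul_div_assoc, Finset.mul_sum]
    refine div_le_div_of_nonneg_right (Finset.sum_le_sum fun i _ => ?_) (Nat.cast_nonneg n)
    rw [hgK]
    refine hanti _ _ (by positivity) (div_le_div_of_nonneg_right (max_le ?_ dist_nonneg) hs.le)
    have := dist_triangle p (x i) (q (x i))
    have h2 := hq (x i)
    rw [dist_comm] at h2
    linarith
  have h2 : K 0 * ∫ y, g (q y) ∂μ ≤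
      ∫ y, K (dist p y / (lam * s)) ∂μ + K 0 * μ.real (Metric.closedBall p a) := by
    have hi1 : Integrable (fun y => K (dist p y / (lam * s))) μ :=
      K.integrable_comp μ (by fun_prop) fun y => by positivity
    have hi2 : Integrable ((Metric.closedBall p a).indicator fun _ => K 0) μ :=
      (integrable_const _).indicator Metric.isClosed_closedBall.measurableSet
    have h3 : K 0 * μ.real (Metric.closedBall p a) =
        ∫ y, (Metric.closedBall p a).indicator (fun _ => K 0) y ∂μ := by
      rw [integral_indicator_const _ Metric.isClosed_closedBall.measurableSet, smul_eq_mul, mul_comm]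
    rw [h3, ← integral_add hi1 hi2, ← integral_const_mul]
    refine integral_mono ?_ (hi1.add hi2) fun y => ?_
    · refine Integrable.const_mul (SimpleFunc.integrable_of_isFiniteMeasure (q.map g)) _
    · simp only [hgK, indicator]
      split_ifs with hy
      · linarith [hanti _ (max (dist p (q y) - ρ) 0 / s) le_rfl (by positivity),
          K.nonneg (dist p y / (lam * s)) (by positivity)]
      · simp only [add_zero]
        refine hanti _ _ (by positivity) ?_
        rw [div_le_div_iff₀ (by positivity) hs]
        have hy' : a < dist p y := by
          rw [Metric.mem_closedBall, not_le, dist_comm] at hy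
          exact hy
        have h4 := dist_triangle p (q y) y
        have h5 := hq y
        have h6 : dist p y - 2 * ρ ≤ max (dist p (q y) - ρ) 0 := by
          refine le_trans ?_ (le_max_left _ _)
          linarith
        have h7 : dist p y ≤ (dist p y - 2 * ρ) * lam := by nlinarith
        have h8 := h7.trans (mul_le_mul_of_nonneg_right h6 (by linarith))
        nlinarith [mul_le_mul_of_nonneg_right h8 hs.le]
  have h3 := mul_le_mul_of_nonneg_left (abs_le.1 (hx g hg0 hg1)).2 hK0.le
  nlinarith

/-- The mirror image of `mean_kernel_le`: the shift is absorbed by contracting the bandwidth. -/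
theorem le_mean_kernel (hq : ∀ y, dist (q y) y ≤ ρ)
    (hx : ∀ g : X → ℝ, (∀ c, 0 ≤ g c) → (∀ c, g c ≤ 1) →
      |(∑ i, g (q (x i))) / n - ∫ y, g (q y) ∂μ| ≤ κ)
    (hρ : 0 < ρ) (hs : 0 < s) (hlam : 1 < lam) (ha : 2 * ρ * lam ≤ a * (lam - 1)) (p : X) :
    ∫ y, K (dist p y / (lam⁻¹ * s)) ∂μ - K 0 * (μ.real (Metric.closedBall p a) + κ) ≤
      (∑ i, K (dist p (x i) / s)) / n := by
  have hK0 := K.zero_pos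
  have hanti : ∀ u v : ℝ, 0 ≤ u → u ≤ v → K v ≤ K u := fun u v hu huv =>
    K.antitoneOn hu (hu.trans huv) huv
  have hlam0 : 0 < lam := by linarith
  set g : X → ℝ := fun c => K ((dist p c + ρ) / s) / K 0 with hg
  have hgK : ∀ c, K 0 * g c = K ((dist p c + ρ) / s) := fun c => by
    simp only [hg]; field_simp
  have hg0 : ∀ c, 0 ≤ g c := fun c => div_nonneg (K.nonneg _ (by positivity)) hK0.le
  have hg1 : ∀ c, g c ≤ 1 := fun c =>
    (div_le_one hK0).2 (hanti _ _ le_rfl (by positivity))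
  have h1 : K 0 * ((∑ i, g (q (x i))) / n) ≤ (∑ i, K (dist p (x i) / s)) / n := by
    rw [← mul_div_assoc, Finset.mul_sum]
    refine div_le_div_of_nonneg_right (Finset.sum_le_sum fun i _ => ?_) (Nat.cast_nonneg n)
    rw [hgK]
    refine hanti _ _ (by positivity) (div_le_div_of_nonneg_right ?_ hs.le)
    linarith [dist_triangle p (q (x i)) (x i), hq (x i)]
  have h2 : ∫ y, K (dist p y / (lam⁻¹ * s)) ∂μ ≤
      K 0 * ∫ y, g (q y) ∂μ + K 0 * μ.real (Metric.closedBall p a) := by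
    have hi1 : Integrable (fun y => K (dist p y / (lam⁻¹ * s))) μ :=
      K.integrable_comp μ (by fun_prop) fun y => by positivity
    have hi2 : Integrable ((Metric.closedBall p a).indicator fun _ => K 0) μ :=
      (integrable_const _).indicator Metric.isClosed_closedBall.measurableSet
    have hi3 : Integrable (fun y => K 0 * g (q y)) μ :=
      Integrable.const_mul (SimpleFunc.integrable_of_isFiniteMeasure (q.map g)) _
    have h3 : K 0 * μ.real (Metric.closedBall p a) =
        ∫ y, (Metric.closedBall p a).indicator (fun _ => K 0) y ∂μ := by
      rw [integral_indicator_const _ Metric.isClosed_closedBall.measurableSet, smul_eq_mul, mul_comm]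
    rw [h3, ← integral_const_mul, ← integral_add hi3 hi2]
    refine integral_mono hi1 (hi3.add hi2) fun y => ?_
    simp only [hgK, indicator]
    split_ifs with hy
    · linarith [hanti _ (dist p y / (lam⁻¹ * s)) le_rfl (by positivity),
        K.nonneg ((dist p (q y) + ρ) / s) (by positivity)]
    · simp only [add_zero]
      refine hanti _ _ (by positivity) ?_
      rw [div_le_div_iff₀ hs (by positivity)]
      have hy' : a < dist p y := by
        rw [Metric.mem_closedBall, not_le, dist_comm] at hy
        exact hy
      have h4 := dist_triangle p y (q y)
      have h5 := hq y
      rw [dist_comm] at h5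
      have h7 : dist p (q y) + ρ ≤ dist p y * lam := by nlinarith
      have h8 : (dist p (q y) + ρ) * lam⁻¹ ≤ dist p y := by
        rw [← div_eq_mul_inv]
        exact (div_le_iff₀ hlam0).2 h7
      nlinarith [mul_le_mul_of_nonneg_right h8 hs.le]
  have h3 := mul_le_mul_of_nonneg_left (abs_le.1 (hx g hg0 hg1)).1 hK0.le
  nlinarith

end Discretization

/-! ### The sample as an empirical measure -/

section NormalizedCount

variable {X : Type*} [MeasurableSpace X] [MeasurableSingletonClass X] {n : ℕ} {x : Fin n → X}

/-- Without ties, counting values is the same as counting indices. -/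
theorem integral_normalizedCount_range (hx : Function.Injective x) (g : Set.range x → ℝ) :
    ∫ p, g p ∂(normalizedCount (Set.range x)) = (∑ i, g ⟨x i, mem_range_self i⟩) / n := by
  have : Fintype (Set.range x) := Fintype.ofFinite _
  have hcard : Nat.card (Set.range x) = n := by
    rw [Nat.card_range_of_injective hx, Nat.card_fin]
  rw [normalizedCount, integral_smul_measure, integral_count, hcard,
    ← (Equiv.ofInjective x hx).sum_comp]
  simp only [ENNReal.toReal_inv, ENNReal.toReal_natCast, smul_eq_mul, div_eq_inv_mul]
  rfl

open Classical in
theorem normalizedCount_range_apply (hx : Function.Injective x) (A : Set (Set.range x)) :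
    normalizedCount (Set.range x) A =
      ENNReal.ofReal ((∑ i, if (⟨x i, mem_range_self i⟩ : Set.range x) ∈ A then 1 else 0) / n) := by
  have h := integral_normalizedCount_range hx (A.indicator 1)
  rw [integral_indicator_one A.toFinite.measurableSet] at h
  simp only [indicator, Pi.one_apply] at h
  rw [← h, ofReal_measureReal]

end NormalizedCount

/-! ### Hausdorff and Prokhorov closeness of the sample -/

section Prokhorov

theorem integral_indicator_simpleFunc {X : Type*} [MeasurableSpace X] {μ : Measure X}
    (q : SimpleFunc X X) (T : Set X) :
    ∫ y, T.indicator (1 : X → ℝ) (q y) ∂μ = μ.real (q ⁻¹' T) := by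
  rw [← integral_indicator_one (q.measurableSet_preimage T)]
  rfl

theorem dist_le_of_simpleFunc_eq {X : Type*} [MetricSpace X] [MeasurableSpace X]
    {q : SimpleFunc X X} {ρ : ℝ} (hq : ∀ y, dist (q y) y ≤ ρ) {y z : X} (h : q y = q z) :
    dist y z ≤ 2 * ρ := by
  have h1 := dist_triangle y (q y) z
  have h2 := hq y
  rw [dist_comm] at h2
  have h3 := hq z
  rw [← h] at h3
  linarith

variable {X : Type*} [MetricSpace X] [MeasurableSpace X] {μ : Measure X}
  [IsProbabilityMeasure μ] {q : SimpleFunc X X} {ρ κ : ℝ} {n : ℕ} {x : Fin n → X}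

/-- Since `κ` is below the mass of every non-null cell, each such cell contains a sample point. Some
non-null cell meets the ball about `y`: `ρ` to reach it, plus its diameter of at most `2 * ρ`. -/
theorem exists_sample_dist_le (hq : ∀ y, dist (q y) y ≤ ρ)
    (hx : ∀ g : X → ℝ, (∀ c, 0 ≤ g c) → (∀ c, g c ≤ 1) →
      |(∑ i, g (q (x i))) / n - ∫ y, g (q y) ∂μ| ≤ κ)
    (hκ : ∀ c ∈ q.range, 0 < μ.real (q ⁻¹' {c}) → κ < μ.real (q ⁻¹' {c}))
    {y : X} (hy : 0 < μ (Metric.ball y ρ)) : ∃ i, dist y (x i) ≤ 3 * ρ := by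
  obtain ⟨c, hc, hpos⟩ : ∃ c ∈ q.range, 0 < μ (Metric.ball y ρ ∩ q ⁻¹' {c}) := by
    by_contra! hcon
    refine hy.ne' (measure_mono_null (t := ⋃ c ∈ q.range, Metric.ball y ρ ∩ q ⁻¹' {c}) ?_ ?_)
    · intro z hz
      exact mem_iUnion₂.2 ⟨q z, q.mem_range_self z, hz, rfl⟩
    · exact (measure_biUnion_null_iff q.range.countable_toSet).2
        fun c hc => le_antisymm (hcon c hc) zero_le
  have hcpos : 0 < μ.real (q ⁻¹' {c}) :=
    ENNReal.toReal_pos (hpos.trans_le (measure_mono inter_subset_right)).ne' (measure_ne_top _ _)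
  obtain ⟨z, hzy, hzc⟩ := nonempty_of_measure_ne_zero hpos.ne'
  have hi : ∃ i, q (x i) = c := by
    by_contra! hcon
    have h := (abs_le.1 (hx (({c} : Set X).indicator 1) (fun c => indicator_nonneg (by simp) c)
      (fun c => indicator_le_self' (by simp) c))).1
    rw [integral_indicator_simpleFunc] at h
    have h0 : ∑ i, ({c} : Set X).indicator (1 : X → ℝ) (q (x i)) = 0 :=
      Finset.sum_eq_zero fun i _ =>
        indicator_of_notMem (show q (x i) ∉ ({c} : Set X) from hcon i) _
    rw [h0] at h
    have := hκ c hc hcpos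
    simp only [zero_div] at h
    linarith
  obtain ⟨i, hi⟩ := hi
  refine ⟨i, ?_⟩
  have h1 : dist z (x i) ≤ 2 * ρ := dist_le_of_simpleFunc_eq hq ((show q z = c from hzc).trans hi.symm)
  have h2 : dist z y < ρ := hzy
  rw [dist_comm] at h2
  linarith [dist_triangle y z (x i)]

variable [BorelSpace X]

/-- Enlarge `A` to the union of the cells it meets: its indicator is a test function of the good
event, and it lies in the `2 * ρ`-thickening. One event thus serves all `A`. -/
theorem normalizedCount_le_thickening (hq : ∀ y, dist (q y) y ≤ ρ)
    (hx : ∀ g : X → ℝ, (∀ c, 0 ≤ g c) → (∀ c, g c ≤ 1) →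
      |(∑ i, g (q (x i))) / n - ∫ y, g (q y) ∂μ| ≤ κ)
    (hκ : 0 ≤ κ) (hinj : Function.Injective x) (A : Set (Set.range x)) :
    normalizedCount (Set.range x) A ≤
      μ {y | ∃ a ∈ A, dist y a.1 ≤ 2 * ρ} + ENNReal.ofReal κ := by
  classical
  set T : Set X := q '' (Subtype.val '' A)
  have h := (abs_le.1 (hx (T.indicator 1) (fun c => indicator_nonneg (by simp) c)
    (fun c => indicator_le_self' (by simp) c))).2
  rw [integral_indicator_simpleFunc] at h
  have h1 : μ (q ⁻¹' T) ≤ μ {y | ∃ a ∈ A, dist y a.1 ≤ 2 * ρ} := by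
    refine measure_mono ?_
    rintro y ⟨_, ⟨a, ha, rfl⟩, hay⟩
    exact ⟨a, ha, dist_le_of_simpleFunc_eq hq hay.symm⟩
  refine le_trans ?_ (add_le_add_left h1 _)
  rw [normalizedCount_range_apply hinj, ← ofReal_measureReal (μ := μ),
    ← ENNReal.ofReal_add measureReal_nonneg hκ]
  refine ENNReal.ofReal_le_ofReal (le_trans (b := (∑ i, T.indicator (1 : X → ℝ) (q (x i))) / (n : ℝ)) ?_
    (by linarith [h]))
  refine div_le_div_of_nonneg_right (Finset.sum_le_sum fun i _ => ?_) (Nat.cast_nonneg n)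
  split_ifs with hi
  · rw [indicator_of_mem (show q (x i) ∈ T from ⟨x i, ⟨_, hi, rfl⟩, rfl⟩)]
    rfl
  · exact indicator_nonneg (by simp) _

theorem le_normalizedCount_thickening (hq : ∀ y, dist (q y) y ≤ ρ)
    (hx : ∀ g : X → ℝ, (∀ c, 0 ≤ g c) → (∀ c, g c ≤ 1) →
      |(∑ i, g (q (x i))) / n - ∫ y, g (q y) ∂μ| ≤ κ)
    (hκ : 0 ≤ κ) (hinj : Function.Injective x) (B : Set X) :
    μ B ≤ normalizedCount (Set.range x) {p | ∃ y ∈ B, dist y p.1 ≤ 2 * ρ} +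
      ENNReal.ofReal κ := by
  classical
  set T : Set X := q '' B
  have h := (abs_le.1 (hx (T.indicator 1) (fun c => indicator_nonneg (by simp) c)
    (fun c => indicator_le_self' (by simp) c))).1
  rw [integral_indicator_simpleFunc] at h
  refine (measure_mono (show B ⊆ q ⁻¹' T from fun y hy => ⟨y, hy, rfl⟩)).trans ?_
  rw [normalizedCount_range_apply hinj, ← ofReal_measureReal (μ := μ),
    ← ENNReal.ofReal_add (by positivity) hκ]
  refine ENNReal.ofReal_le_ofReal (le_trans (b := (∑ i, T.indicator (1 : X → ℝ) (q (x i))) / (n : ℝ) + κ)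
    (by linarith [h]) (add_le_add_left ?_ _))
  refine div_le_div_of_nonneg_right (Finset.sum_le_sum fun i _ => ?_) (Nat.cast_nonneg n)
  by_cases hi : q (x i) ∈ T
  · obtain ⟨y, hy, hyi⟩ := hi
    rw [if_pos ⟨y, hy, dist_le_of_simpleFunc_eq hq hyi⟩]
    exact indicator_le_self' (by simp) _
  · rw [indicator_of_notMem hi]
    split_ifs <;> norm_num

end Prokhorov

/-! ### Uniform density estimate -/

section DensityEstimate

variable {d : ℕ} {f : E d → ℝ} {K : DensityKernel}

/-- Each of three sources costs at most `δ * v_s`: smoothing bias (`hb`), the factor `lam ^ d` from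
the changed bandwidth, and sampling with discretization (`herr`). The last is assumed only at the
smallest bandwidth `s₀`, as `v_s` increases with `s`. -/
theorem abs_mean_kernel_sub_le (hK : K.FiniteVolume d) (hf : IsProbabilityDensity f)
    (hcont : Continuous f) {M : ℝ} (hM : ∀ x, f x ≤ M)
    {δ b lam ρ a κ s s₀ : ℝ} (hδ : 0 < δ) (hlam : 1 < lam) (hlam2 : lam ≤ 2)
    (hlamd : lam ^ d ≤ 1 + δ / (M + δ))
    (hb : ∀ s, 0 < s → s ≤ b → ∀ p : E d,
      |(∫ y, f y * K (dist p y / s)) - kernelVolume d K s * f p| ≤ δ * kernelVolume d K s)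
    {q : SimpleFunc (tsupport f) (tsupport f)} (hρ : 0 < ρ) (hq : ∀ y, dist (q y) y ≤ ρ)
    {n : ℕ} {x : Fin n → tsupport f}
    (hx : ∀ g : tsupport f → ℝ, (∀ c, 0 ≤ g c) → (∀ c, g c ≤ 1) →
      |(∑ i, g (q (x i))) / n - ∫ y, g (q y) ∂(densityMeasure f)| ≤ κ)
    (ha : 2 * ρ * lam ≤ a * (lam - 1)) (hs₀ : 0 < s₀) (hs₀s : s₀ ≤ s) (hsb : 2 * s ≤ b)
    (p : tsupport f)
    (herr : K 0 * ((densityMeasure f).real (Metric.closedBall p a) + κ) ≤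
      δ * kernelVolume d K s₀) :
    |(∑ i, K (dist p (x i) / s)) / n - kernelVolume d K s * f p| ≤
      3 * δ * kernelVolume d K s := by
  have := isProbabilityMeasure_densityMeasure hf
  have hs : 0 < s := hs₀.trans_le hs₀s
  have hlam0 : 0 < lam := by linarith
  have hv := kernelVolume_pos hK hs
  have hM0 : 0 ≤ M := (hf.nonneg 0).trans (hM 0)
  have hint : ∀ s', 0 < s' → ∫ y, K (dist p y / s') ∂(densityMeasure f) =
      ∫ y, f y * K (dist (p : E d) y / s') := fun s' hs' =>
    integral_densityMeasure hf hcont (fun y => K (dist (p : E d) y / s'))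
      (K.measurable_comp (by fun_prop) fun y => by positivity)
  have hvol : kernelVolume d K s₀ ≤ kernelVolume d K s := by
    rw [kernelVolume_eq d K hs₀, kernelVolume_eq d K hs]
    exact mul_le_mul_of_nonneg_right (pow_le_pow_left₀ hs₀.le hs₀s d) (kernelVolume_one_pos hK).le
  have hscale : ∀ c, 0 < c → kernelVolume d K (c * s) = c ^ d * kernelVolume d K s := by
    intro c hc
    rw [kernelVolume_eq d K (mul_pos hc hs), kernelVolume_eq d K hs, mul_pow, mul_assoc]
  have hinv : lam⁻¹ ≤ 1 := inv_le_one_of_one_le₀ hlam.le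
  have hup := mean_kernel_le (K := K) (s := s) hq hx hs hlam ha p
  have hlo := le_mean_kernel (K := K) (s := s) hq hx hρ hs hlam ha p
  have hb1 := hb (lam * s) (by positivity) (by nlinarith) p
  have hb2 := hb (lam⁻¹ * s) (by positivity) (by nlinarith) p
  rw [hscale _ hlam0, ← hint _ (by positivity)] at hb1
  rw [hscale _ (by positivity), ← hint _ (by positivity)] at hb2
  have hL1 : 1 ≤ lam ^ d := one_le_pow₀ hlam.le
  have hfp := hf.nonneg p
  have hfM := hM p
  set v := kernelVolume d K s
  set L := lam ^ d
  have hLinv : lam⁻¹ ^ d = L⁻¹ := inv_pow lam d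
  rw [hLinv] at hb2
  -- The shape of `hlamd` is chosen for this, via `f p + δ ≤ M + δ`.
  have hLf : L * (f p + δ) ≤ f p + 2 * δ := by
    have h1 : δ / (M + δ) * (f p + δ) ≤ δ := by
      rw [div_mul_eq_mul_div, div_le_iff₀ (by positivity)]
      exact mul_le_mul_of_nonneg_left (by linarith) hδ.le
    have h2 := mul_le_mul_of_nonneg_right hlamd (show 0 ≤ f p + δ by linarith)
    linarith
  have hLf' : f p - 2 * δ ≤ L⁻¹ * (f p - δ) := by
    rw [← div_eq_inv_mul, le_div_iff₀ (by positivity)]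
    nlinarith
  have herr' : K 0 * ((densityMeasure f).real (Metric.closedBall p a) + κ) ≤ δ * v :=
    herr.trans (mul_le_mul_of_nonneg_left hvol hδ.le)
  have hb1' := (abs_le.1 hb1).2
  have hb2' := (abs_le.1 hb2).1
  rw [abs_le]
  constructor
  · have := mul_le_mul_of_nonneg_right hLf' hv.le
    nlinarith
  · have := mul_le_mul_of_nonneg_right hLf hv.le
    nlinarith

end DensityEstimate

/-! ### Consistency for a fixed tolerance -/

section Consistency

variable {d : ℕ} {K : DensityKernel} {Θ : Type*} {γ : Θ → ParamCurve} {f : E d → ℝ}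

theorem ParamCurve.slice_at' {X : Type*} (c : ParamCurve) (H : HierarchicalClustering₃ X) {r : ℝ}
    (hr : 0 < r) (h : (r : EReal) < c.max) :
    (c.slice H).at' r hr = H (⟨c.s r, c.s_pos r hr h⟩, ⟨c.t r, c.t_pos r hr h⟩,
      OrderDual.toDual ⟨c.k r, c.k_pos r hr h⟩) :=
  dif_pos h

theorem gammaBarLinkage_at' (hd : 0 < d) (hK : K.FiniteVolume d) (hγ : AdmissibleFamily γ) (θ : Θ)
    (X : Type) [MetricSpace X] [Finite X] [MeasurableSpace X] [BorelSpace X] (r : ℝ) (hr : 0 < r) :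
    (gammaBarLinkage hd hK γ hγ θ X).at' r hr = Clustering.ofSubset
      (kernelFiltration K (normalizedCount X) (((γ θ).reparam hd (hγ.covering θ) hK).s r)
        (((γ θ).reparam hd (hγ.covering θ) hK).k r))
      (singleLinkage _ ⟨((γ θ).reparam hd (hγ.covering θ) hK).t r,
        ((γ θ).reparam hd (hγ.covering θ) hK).t_pos r hr (EReal.coe_lt_top r)⟩) :=
  ParamCurve.slice_at' _ _ hr (EReal.coe_lt_top r)

theorem reparam_k_eq {γ : ParamCurve} (hd : 0 < d) (hγ : γ.Covering) (hK : K.FiniteVolume d)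
    {r : ℝ} (hr : 0 < r) :
    (γ.reparam hd hγ hK).k r = r * kernelVolume d K ((γ.reparam hd hγ hK).s r) := by
  have h := ParamCurve.phi_phiInv hd hγ hK hr
  have hm := ParamCurve.phiInv_mem hd hγ hK hr
  exact (div_eq_iff (kernelVolume_pos hK (γ.s_pos _ hm.1 hm.2)).ne').1 h

/-- For every curve of the family with sufficiently small bandwidth and linkage scale, the
probability that the interleaving fails tends to zero. -/
theorem exists_tendsto_not_measuredInterleavedWrt (hd : 0 < d) (hK : K.FiniteVolume d)
    (hγ : AdmissibleFamily γ) (hf : IsProbabilityDensity f) (hcont : Continuous f)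
    (hcomp : HasCompactSupport f) {ε : ℝ} (hε : 0 < ε) (hε1 : ε ≤ 1) :
    ∃ b : ℝ, 0 < b ∧ ∀ θ, (∀ r ∈ (γ θ).dom, (γ θ).s r < b ∧ (γ θ).t r < b) →
      Tendsto (fun n : ℕ => (Measure.pi fun _ : Fin n => densityMeasure f)
        {x : Fin n → tsupport f | ¬ MeasuredInterleavedWrt
          (normalizedCount (Set.range x)) (densityMeasure f)
          (gammaBarLinkage hd hK γ hγ θ (Set.range x)) (densityContour f)
          (closestPointCorrespondence (fun p : Set.range x => (p.1 : E d))
            (fun y : tsupport f => (y : E d))) ε ε}) atTop (𝓝 0) := by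
  have := isProbabilityMeasure_densityMeasure hf
  have := nullSingletonClass_densityMeasure (f := f) hd
  have : Nonempty (tsupport f) := nonempty_of_isProbabilityMeasure (densityMeasure f)
  have : CompactSpace (tsupport f) := isCompact_iff_compactSpace.1 hcomp
  obtain ⟨M, hMnorm⟩ := hcomp.exists_bound_of_continuous hcont
  have hM : ∀ x, f x ≤ M := fun x => (le_abs_self _).trans (hMnorm x)
  have hM0 : 0 ≤ M := (hf.nonneg 0).trans (hM 0)
  have huc : UniformContinuous f := hcomp.uniformContinuous_of_continuous hcont
  have hK0 := K.zero_pos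
  -- The density estimate loses `3 * δ = ε / 4`.
  obtain ⟨δ, hδ⟩ : ∃ δ, δ = ε / 12 := ⟨_, rfl⟩
  have hδ0 : 0 < δ := by rw [hδ]; positivity
  obtain ⟨b₁, hb₁, hsmooth⟩ := exists_abs_kernel_smoothing_sub_le hK hcont huc hf.nonneg hM hδ0
  obtain ⟨b₂, hb₂, hmod⟩ := Metric.uniformContinuous_iff.1 huc (ε / 4) (by positivity)
  obtain ⟨lam, hlam, hlam2, hlamd⟩ : ∃ lam : ℝ, 1 < lam ∧ lam ≤ 2 ∧ lam ^ d ≤ 1 + δ / (M + δ) := by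
    have h1 : Tendsto (fun l : ℝ => l ^ d) (𝓝[>] 1) (𝓝 (1 ^ d)) :=
      ((continuous_pow d).tendsto 1).mono_left nhdsWithin_le_nhds
    rw [one_pow] at h1
    have h2 := h1.eventually (gt_mem_nhds (lt_add_of_pos_right 1
      (show 0 < δ / (M + δ) by positivity)))
    obtain ⟨l, hl1, hl2⟩ := (h2.and (Ioc_mem_nhdsGT one_lt_two)).exists
    exact ⟨l, hl2.1, hl2.2, hl1.le⟩
  -- The first half leaves room for the dilated bandwidth `lam * s ≤ 2 * s ≤ b₁`; the second turns a
  -- non-strict bound into the strict one of uniform continuity.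
  refine ⟨min (b₁ / 2) (b₂ / 2), by positivity, fun θ hθ => ?_⟩
  obtain ⟨c, hc⟩ : ∃ c, c = (γ θ).reparam hd (hγ.covering θ) hK := ⟨_, rfl⟩
  have hcs : ∀ r, 0 < r → 0 < c.s r := fun r hr => by
    rw [hc]; exact ParamCurve.s_pos _ r hr (EReal.coe_lt_top r)
  have hct : ∀ r, 0 < r → 0 < c.t r := fun r hr => by
    rw [hc]; exact ParamCurve.t_pos _ r hr (EReal.coe_lt_top r)
  have hcsb : ∀ r, 0 < r → 2 * c.s r ≤ b₁ := fun r hr => by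
    have h := (hθ _ (ParamCurve.phiInv_mem hd (hγ.covering θ) hK hr)).1.trans_le (min_le_left _ _)
    rw [hc]
    change 2 * (γ θ).s ((γ θ).phiInv d K r) ≤ b₁
    linarith
  have hctb : ∀ r, 0 < r → c.t r ≤ b₂ / 2 := fun r hr => by
    rw [hc]
    exact ((hθ _ (ParamCurve.phiInv_mem hd (hγ.covering θ) hK hr)).2.trans_le
      (min_le_right _ _)).le
  have hmax : c.max = ⊤ := by rw [hc]; rfl
  have hdom : ∀ r : ℝ, 0 < r → r ∈ {r : ℝ | 0 < r ∧ (r : EReal) < c.max} := fun r hr =>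
    ⟨hr, hmax ▸ EReal.coe_lt_top r⟩
  have hsanti : ∀ r r', 0 < r → r ≤ r' → c.s r' ≤ c.s r := fun r r' hr h =>
    c.s_anti (hdom r hr) (hdom r' (hr.trans_le h)) h
  have htanti : ∀ r r', 0 < r → r ≤ r' → c.t r' ≤ c.t r := fun r r' hr h =>
    c.t_anti (hdom r hr) (hdom r' (hr.trans_le h)) h
  have hM1 : 0 < M + 1 := by linarith
  have hs₀ := hcs (M + 1) hM1
  have hv₀ := kernelVolume_pos hK hs₀
  -- The sample is only `3 * ρ`-dense, hence the ninefold bound. The exceptional ball has radius `a`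
  -- proportional to `ρ`, so its mass, at most `M` times its volume, vanishes with `ρ` because `d >
  -- 0`.
  obtain ⟨ρ, hρ, hρt, hρv⟩ : ∃ ρ, 0 < ρ ∧ 3 * (3 * ρ) ≤ c.t (M + 1) ∧
      K 0 * (M * ((2 * ρ * lam / (lam - 1)) ^ d * volume.real (Metric.ball (0 : E d) 1))) ≤
        δ * kernelVolume d K (c.s (M + 1)) / 2 := by
    have h1 : Tendsto (fun ρ : ℝ => K 0 * (M * ((2 * ρ * lam / (lam - 1)) ^ d *
        volume.real (Metric.ball (0 : E d) 1)))) (𝓝[>] 0) (𝓝 (K 0 * (M * ((2 * 0 * lam /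
          (lam - 1)) ^ d * volume.real (Metric.ball (0 : E d) 1))))) := by
      refine Tendsto.mono_left (Continuous.tendsto ?_ 0) nhdsWithin_le_nhds
      fun_prop
    simp only [mul_zero, zero_mul, zero_div, zero_pow hd.ne'] at h1
    have h2 := h1.eventually (gt_mem_nhds
      (show 0 < δ * kernelVolume d K (c.s (M + 1)) / 2 by positivity))
    have ht₀ := hct (M + 1) hM1
    obtain ⟨ρ, hρ1, hρ2⟩ := (h2.and (Ioc_mem_nhdsGT
      (show 0 < c.t (M + 1) / 9 by positivity))).exists
    exact ⟨ρ, hρ2.1, by linarith [hρ2.2], hρ1.le⟩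
  obtain ⟨q, hq⟩ := exists_simpleFunc_dist_le (X := tsupport f) hρ
  obtain ⟨κ, hκ, hκε, hκv, hκq⟩ : ∃ κ, 0 < κ ∧ κ ≤ ε ∧
      K 0 * κ ≤ δ * kernelVolume d K (c.s (M + 1)) / 2 ∧
      ∀ c ∈ q.range, 0 < (densityMeasure f).real (q ⁻¹' {c}) →
        κ < (densityMeasure f).real (q ⁻¹' {c}) := by
    have h1 : ∀ᶠ κ in 𝓝[>] (0 : ℝ), ∀ c ∈ q.range, 0 < (densityMeasure f).real (q ⁻¹' {c}) →
        κ < (densityMeasure f).real (q ⁻¹' {c}) := by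
      rw [Finset.eventually_all]
      intro c _
      by_cases h : 0 < (densityMeasure f).real (q ⁻¹' {c})
      · filter_upwards [Ioo_mem_nhdsGT h] with κ hκ _ using hκ.2
      · exact Eventually.of_forall fun κ h' => absurd h' h
    have h2 : 0 < min ε (δ * kernelVolume d K (c.s (M + 1)) / 2 / K 0) := by positivity
    obtain ⟨κ, hκ1, hκ2⟩ := (h1.and (Ioc_mem_nhdsGT h2)).exists
    refine ⟨κ, hκ2.1, hκ2.2.trans (min_le_left _ _), ?_, hκ1⟩
    have := hκ2.2.trans (min_le_right _ _)
    rw [le_div_iff₀ hK0] at this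
    linarith
  have hgood : ∀ n : ℕ, 0 < n → ∀ x : Fin n → tsupport f, Function.Injective x →
      (∀ g : tsupport f → ℝ, (∀ c, 0 ≤ g c) → (∀ c, g c ≤ 1) →
        |(∑ i, g (q (x i))) / n - ∫ y, g (q y) ∂(densityMeasure f)| ≤ κ) →
      MeasuredInterleavedWrt
        (normalizedCount (Set.range x)) (densityMeasure f)
        (gammaBarLinkage hd hK γ hγ θ (Set.range x)) (densityContour f)
        (closestPointCorrespondence (fun p : Set.range x => (p.1 : E d))
          (fun y : tsupport f => (y : E d))) ε ε := by
    intro n hn x hinj hx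
    have : Nonempty (Set.range x) := ⟨⟨x ⟨0, hn⟩, mem_range_self _⟩⟩
    refine measuredInterleavedWrt_densityContour hcont hM0 hM
      (gammaBarLinkage hd hK γ hγ θ (Set.range x))
      (fun r => kernelFiltration K (normalizedCount (Set.range x)) (c.s r) (c.k r)) c.t hct
      ?_ htanti (b := b₂ / 2) (ρ := 3 * ρ) hε hε1 ?_ hctb (by positivity) hρt ?_ ?_ ?_ ?_
    · subst hc
      exact fun r hr => gammaBarLinkage_at' hd hK hγ θ (Set.range x) r hr
    · intro y z hyz
      rw [← Real.dist_eq]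
      exact (hmod (lt_of_le_of_lt hyz (half_lt_self hb₂))).le
    · intro r hr hrM p
      have hr0 : 0 < r := by linarith
      have hv := kernelVolume_pos hK (hcs r hr0)
      have hk : c.k r = r * kernelVolume d K (c.s r) := by
        rw [hc]
        exact reparam_k_eq hd (hγ.covering θ) hK hr0
      have hden : localDensity K (normalizedCount (Set.range x)) (c.s r) p =
          (∑ i, K (dist p.1 (x i) / c.s r)) / n := integral_normalizedCount_range hinj _
      have hest := abs_mean_kernel_sub_le (a := 2 * ρ * lam / (lam - 1)) hK hf hcont hM hδ0 hlam
        hlam2 hlamd hsmooth hρ hq hx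
        (div_mul_cancel₀ _ (sub_pos.2 hlam).ne').ge hs₀ (hsanti r (M + 1) hr0 hrM) (hcsb r hr0) p.1
        (by
          have h1 := densityMeasure_real_closedBall_le hM0 hM p.1
            (a := 2 * ρ * lam / (lam - 1))
            (div_nonneg (by positivity) (sub_pos.2 hlam).le)
          have h2 := mul_le_mul_of_nonneg_left h1 hK0.le
          linarith)
      rw [← hden, abs_le] at hest
      have h3 : 3 * δ = ε / 4 := by rw [hδ]; ring
      rw [h3] at hest
      change (c.k r ≤ localDensity K _ _ p → _) ∧ (_ → c.k r ≤ localDensity K _ _ p)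
      rw [hk]
      constructor
      · intro h
        have h4 : r * kernelVolume d K (c.s r) ≤ (f p.1 + ε / 4) * kernelVolume d K (c.s r) := by
          linarith [hest.2, mul_comm (kernelVolume d K (c.s r)) (f p.1)]
        linarith [le_of_mul_le_mul_right h4 hv]
      · intro h
        have h4 := mul_le_mul_of_nonneg_right h hv.le
        linarith [hest.1, mul_comm (kernelVolume d K (c.s r)) (f p.1)]
    · intro y
      obtain ⟨i, hi⟩ := exists_sample_dist_le hq hx hκq (densityMeasure_ball_pos hf hcont y hρ)
      exact ⟨⟨x i, mem_range_self i⟩, hi⟩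
    · intro A
      refine (normalizedCount_le_thickening hq hx hκ.le hinj A).trans
        (add_le_add (measure_mono ?_) (ENNReal.ofReal_le_ofReal hκε))
      rintro y ⟨a, ha, h⟩
      exact ⟨a, ha, by linarith⟩
    · intro B
      refine (le_normalizedCount_thickening hq hx hκ.le hinj B).trans
        (add_le_add (measure_mono ?_) (ENNReal.ofReal_le_ofReal hκε))
      rintro p ⟨y, hy, h⟩
      exact ⟨y, hy, by linarith⟩
  refine tendsto_of_tendsto_of_tendsto_of_le_of_le' tendsto_const_nhds
    (tendsto_pi_not_uniform_mean (μ := densityMeasure f) q hκ)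
    (Eventually.of_forall fun _ => zero_le) ?_
  filter_upwards [eventually_gt_atTop 0] with n hn
  -- Failure requires a tie, which has probability zero, or leaving the good event.
  refine (measure_mono ?_).trans ((measure_union_le {x | ¬ Function.Injective x}
    {x | ¬ ∀ g : tsupport f → ℝ, (∀ c, 0 ≤ g c) → (∀ c, g c ≤ 1) →
      |(∑ i, g (q (x i))) / n - ∫ y, g (q y) ∂(densityMeasure f)| ≤ κ}).trans_eq
    (by rw [pi_not_injective_eq_zero, zero_add]))
  intro x hx
  by_cases hinj : Function.Injective x
  · exact Or.inr fun h => hx (hgood n hn x hinj h)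
  · exact Or.inl hinj

end Consistency

end GammaLinkage

end

/-! ### Diagonal choice of parameters and conclusion -/

theorem mainTheorem4 {d : ℕ} (hd : 0 < d) {K : GammaLinkage.DensityKernel}
    (hK : K.FiniteVolume d) {Θ : Type*} (γ : Θ → GammaLinkage.ParamCurve)
    (hγ : GammaLinkage.AdmissibleFamily γ) (f : GammaLinkage.E d → ℝ)
    (hf : GammaLinkage.IsProbabilityDensity f) (hcont : Continuous f)
    (hcomp : HasCompactSupport f) :
    GammaLinkage.MIConsistent (GammaLinkage.gammaBarLinkage hd hK γ hγ) f := by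
  have hex : ∀ k : ℕ, ∃ θ, Tendsto (fun n : ℕ =>
      (Measure.pi fun _ : Fin n => GammaLinkage.densityMeasure f)
        {x : Fin n → tsupport f | ¬ GammaLinkage.MeasuredInterleavedWrt
          (GammaLinkage.normalizedCount (Set.range x)) (GammaLinkage.densityMeasure f)
          (GammaLinkage.gammaBarLinkage hd hK γ hγ θ (Set.range x)) (GammaLinkage.densityContour f)
          (GammaLinkage.closestPointCorrespondence
            (fun p : Set.range x => (p.1 : GammaLinkage.E d))
            (fun y : tsupport f => (y : GammaLinkage.E d)))
          (1 / ((k : ℝ) + 1)) (1 / ((k : ℝ) + 1))}) atTop (𝓝 0) := by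
    intro k
    obtain ⟨b, hb, h⟩ := GammaLinkage.exists_tendsto_not_measuredInterleavedWrt hd hK hγ hf hcont
      hcomp (ε := 1 / ((k : ℝ) + 1)) (by positivity) (by
        rw [div_le_one (by positivity)]
        linarith [Nat.cast_nonneg (α := ℝ) k])
    obtain ⟨θ, hθ⟩ := hγ.small b hb
    exact ⟨θ, h θ hθ⟩
  choose θ hθ using hex
  -- The tolerance `1 / (k + 1)` also bounds the failure probability, so both vanish along `κ n`.
  obtain ⟨κ, hκ, hκθ⟩ := GammaLinkage.exists_seq_tendsto_atTop_eventually fun k =>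
    (hθ k).eventually (ge_mem_nhds (ENNReal.ofReal_pos.2
      (show (0 : ℝ) < 1 / ((k : ℝ) + 1) by positivity)))
  refine ⟨fun n => θ (κ n), fun ε hε => ?_⟩
  have hlim : Tendsto (fun n => 1 / ((κ n : ℝ) + 1)) atTop (𝓝 0) :=
    tendsto_one_div_add_atTop_nhds_zero_nat.comp hκ
  have hlim' : Tendsto (fun n => ENNReal.ofReal (1 / ((κ n : ℝ) + 1))) atTop (𝓝 0) := by
    simpa using ENNReal.tendsto_ofReal hlim
  refine tendsto_of_tendsto_of_tendsto_of_le_of_le' tendsto_const_nhds hlim'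
    (Eventually.of_forall fun _ => zero_le) ?_
  filter_upwards [hκθ, hlim.eventually (gt_mem_nhds hε)] with n hn hnε
  refine (measure_mono ?_).trans hn
  exact fun x hx hmi => hx (hmi.mono hnε.le hnε.le)
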